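/- For a rational $\lambda>1$, a $\lambda$-NDA (nondeterministic discounted-sum automaton with discount factor $\lambda$) over a finite alphabet $\Sigma$ is a tuple $\mathcal A=\langle\Sigma,Q,\iota,\delta,\gamma\rangle$ with a finite set $Q$ of states, initial states $\iota\subseteq Q$, a transition relation $\delta\subseteq Q\times\Sigma\times Q$ and a weight function $\gamma:\delta\to\mathbb Q$. Automata are complete: $\iota\neq\emptyset$, and for all $q\in Q$, $\sigma\in\Sigma$ there is $q'\in Q$ with $(q,\sigma,q')\in\delta$. A run of $\mathcal A$ on a finite or infinite word $w=\sigma_0\sigma_1\cdots$ is a sequence of states $p_0p_1\cdots$ with $p_0\in\iota$ and $(p_i,\sigma_i,p_{i+1})\in\delta$ for every letter $\sigma_i$ of $w$; its value is $\sum_{i}\gamma(p_i,\sigma_i,p_{i+1})/\lambda^{i}$, the sum ranging over the positions of $w$. The value $\mathcal A(w)$ is the infimum of the values of all runs of $\mathcal A$ on $w$. **Corollary.** Each of the following six problems is decidable. The input consists of a finite alphabet $\Sigma$, integers $\lambda_A,\lambda_B\ge 2$ (equal or different), a $\lambda_A$-NDA $\mathcal A$ and a $\lambda_B$-NDA $\mathcal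 B$ over $\Sigma$ (all given by explicit finite descriptions). The questions are: - on finite words: whether $\mathcal A(w)>\mathcal B(w)$ for all $w\in\Sigma^+$; whether $\mathcal A(w)\ge\mathcal B(w)$ for all $w\in\Sigma^+$; whether $\mathcal A(w)=\mathcal B(w)$ for all $w\in\Sigma^+$; - on infinite words: whether $\mathcal A(w)>\mathcal B(w)$ for all $w\in\Sigma^\omega$; whether $\mathcal A(w)\ge\mathcal B(w)$ for all $w\in\Sigma^\omega$; whether $\mathcal A(w)=\mathcal B(w)$ for all $w\in\Sigma^\omega$. -/

import Mathlib

/-- A (nondeterministic) discounted-sum automaton with discount factor `lam`, a `lam`-NDA, over the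
alphabet `α` and with set of states `Q` (both are finite wherever this is used).  The weight
function matters only on `trans`. -/
structure NDA (lam : ℚ) (α Q : Type) where
  init : Set Q
  trans : Set (Q × α × Q)
  weight : Q × α × Q → ℚ

namespace NDA

variable {lam : ℚ} {α Q : Type}

/-- There is an initial state, and every state has at least one successor on every letter. -/
def Complete (A : NDA lam α Q) : Prop :=
  A.init.Nonempty ∧ ∀ q a, ∃ q', (q, a, q') ∈ A.trans

/-- `p 0, w 0, p 1, …, w (n-1), p n` is a run of `A` on the finite word `w` of length `n`. -/
def IsFinRun (A : NDA lam α Q) {n : ℕ} (w : Fin n → α) (p : Fin (n + 1) → Q) : Prop :=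
  p 0 ∈ A.init ∧ ∀ i : Fin n, (p i.castSucc, w i, p i.succ) ∈ A.trans

/-- The discounted sum of the weights along a finite run: the weight of the `i`-th transition is
divided by `lam ^ i`. -/
noncomputable def finRunValue (A : NDA lam α Q) {n : ℕ} (w : Fin n → α) (p : Fin (n + 1) → Q) : ℝ :=
  ∑ i : Fin n, (A.weight (p i.castSucc, w i, p i.succ) : ℝ) / (lam : ℝ) ^ (i : ℕ)

/-- The value of a finite word: the infimum of the values of the runs on it. -/
noncomputable def finValue (A : NDA lam α Q) {n : ℕ} (w : Fin n → α) : EReal :=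
  sInf {v : EReal | ∃ p : Fin (n + 1) → Q, A.IsFinRun w p ∧ v = (A.finRunValue w p : EReal)}

/-- `p 0, w 0, p 1, w 1, p 2, …` is a run of `A` on the infinite word `w`. -/
def IsInfRun (A : NDA lam α Q) (w : ℕ → α) (p : ℕ → Q) : Prop :=
  p 0 ∈ A.init ∧ ∀ i : ℕ, (p i, w i, p (i + 1)) ∈ A.trans

/-- The discounted sum of the weights along an infinite run.  The series converges absolutely when
`1 < lam` and the sets of letters and of states are finite. -/
noncomputable def infRunValue (A : NDA lam α Q) (w : ℕ → α) (p : ℕ → Q) : ℝ :=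
  ∑' i : ℕ, (A.weight (p i, w i, p (i + 1)) : ℝ) / (lam : ℝ) ^ i

/-- The value of an infinite word: the infimum of the values of the runs on it. -/
noncomputable def infValue (A : NDA lam α Q) (w : ℕ → α) : EReal :=
  sInf {v : EReal | ∃ p : ℕ → Q, A.IsInfRun w p ∧ v = (A.infRunValue w p : EReal)}

end NDA

/-- A finite description of an NDA with a natural number as discount factor: its discount factor,
its number of states (the states are `0, …, numStates - 1`), the list of its initial states, and its
transition table.  An entry `((q, a, q'), (x, y))` of the table is the transition from `q` to `q'`
over the letter `a`, with the rational weight `x / (y + 1)`. -/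
structure NDACode where
  discount : ℕ
  numStates : ℕ
  init : List ℕ
  table : List ((ℕ × ℕ × ℕ) × (ℤ × ℕ))

namespace NDACode

/-- The description of an automaton as a tuple, which is what an algorithm gets. -/
def equivProd :
    NDACode ≃ ℕ × ℕ × List ℕ × List ((ℕ × ℕ × ℕ) × (ℤ × ℕ)) where
  toFun c := (c.discount, c.numStates, c.init, c.table)
  invFun t := ⟨t.1, t.2.1, t.2.2.1, t.2.2.2⟩
  left_inv _ := rfl
  right_inv _ := rfl

instance : Primcodable NDACode := Primcodable.ofEquiv _ equivProd

/-- The entry of the table for the transition `(q, a, q')`, if there is one (if a table lists a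
transition twice, the first entry counts). -/
def entry (c : NDACode) (m : ℕ) (t : Fin c.numStates × Fin m × Fin c.numStates) :
    Option (ℤ × ℕ) :=
  c.table.lookup ((t.1 : ℕ), (t.2.1 : ℕ), (t.2.2 : ℕ))

/-- The automaton that a code describes, over the alphabet `{0, …, m - 1}`. -/
def toNDA (c : NDACode) (m : ℕ) : NDA (c.discount : ℚ) (Fin m) (Fin c.numStates) where
  init := {q | (q : ℕ) ∈ c.init}
  trans := {t | (c.entry m t).isSome}
  weight t := ((c.entry m t).map fun x => (x.1 : ℚ) / ((x.2 : ℚ) + 1)).getD 0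

end NDACode

/-- The input of the comparison problems: the size of the common alphabet and two automata. -/
structure NDAPair where
  alphabetSize : ℕ
  fst : NDACode
  snd : NDACode

namespace NDAPair

/-- The input as a tuple. -/
def equivProd : NDAPair ≃ ℕ × NDACode × NDACode where
  toFun x := (x.alphabetSize, x.fst, x.snd)
  invFun t := ⟨t.1, t.2.1, t.2.2⟩
  left_inv _ := rfl
  right_inv _ := rfl

instance : Primcodable NDAPair := Primcodable.ofEquiv _ equivProd

/-- The first automaton of the input. -/
abbrev A (x : NDAPair) : NDA (x.fst.discount : ℚ) (Fin x.alphabetSize) (Fin x.fst.numStates) :=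
  x.fst.toNDA x.alphabetSize

/-- The second automaton of the input. -/
abbrev B (x : NDAPair) : NDA (x.snd.discount : ℚ) (Fin x.alphabetSize) (Fin x.snd.numStates) :=
  x.snd.toNDA x.alphabetSize

/-- Both discount factors are integers greater than one, and both automata are complete. -/
def Valid (x : NDAPair) : Prop :=
  2 ≤ x.fst.discount ∧ 2 ≤ x.snd.discount ∧ x.A.Complete ∧ x.B.Complete

end NDAPair

/-! Multiplying by a common denominator makes all weights integers. Because the discount factor is
an integer, each automaton can then be determinized: after `n` letters it suffices to know, for
every state, by how much its cheapest run exceeds the cheapest run overall. Multiplied by the `n`-th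
power of the discount factor this gap is an integer, and a large gap never closes, so gaps may be
truncated (`Complete.exists_determinization`). The product of the two determinizations is a finite
deterministic system with two integer costs, discounted by `α` and `β`, and the difference of the
two automata on a word is the sum of the two discounted costs, the second one negated
(`Valid.exists_system`). What remains is to decide the sign of this sum over all words.

If `α = β`, the costs merge into one. If `α < β`, then after `N` letters the ratio `(β / α) ^ N` is
so large that the smallest possible loss in the `α`-cost outweighs any gain in the `β`-cost. The
best continuation of a prefix of length `N` is therefore lexicographic: optimal for the `α`-cost,
and among such words optimal for the `β`-cost. Both optimal values solve Bellman equations over a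
finite system, so they are rationals with a computable common denominator. Hence every word can be
improved to one whose value is a multiple of `1 / H` for a computable `H`
(`IsBounded.exists_improvement`). The tails beyond a computable horizon are smaller than `1 / (2 *
H)`, so prefixes of that length reveal the sign.

Finite words become infinite ones through a stop letter that leads to a free absorbing state. For
strict comparison an infinite word of value zero is no counterexample, so stopping must be
preserved: either the improvement is strict, and a truncation is already negative, or the word is
lexicographically optimal after `N` letters, and the absorbing state can be reached early by optimal
transitions at the same value (`IsBounded.exists_short`).

The algorithm itself never determinizes. It enumerates the words and runs of bounded length and
compares natural numbers (`Check`); all bounds are primitive recursive in the code of the input. -/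

namespace DiscountedSystem

/-! ### Discounted sums of bounded sequences. -/

variable {S Sig : Type}

/-- The state of a deterministic system after reading the first `n` letters of `w` from `s`. -/
def stateAt (step : S → Sig → S) (s : S) (w : ℕ → Sig) : ℕ → S
  | 0 => s
  | n + 1 => step (stateAt step s w n) (w n)

/-- The cost of the `n`-th transition on the word `w`. -/
def costAt (step : S → Sig → S) (c : S → Sig → ℤ) (s : S) (w : ℕ → Sig) (n : ℕ) : ℤ :=
  c (stateAt step s w n) (w n)

/-- The discounted sum of a sequence of integers. -/
noncomputable def disc (r : ℕ) (c : ℕ → ℤ) : ℝ := ∑' i, (c i : ℝ) / (r : ℝ) ^ i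

/-- The discounted sum of the first `n` entries of a sequence of integers. -/
noncomputable def discPrefix (r : ℕ) (c : ℕ → ℤ) (n : ℕ) : ℝ :=
  ∑ i ∈ Finset.range n, (c i : ℝ) / (r : ℝ) ^ i

theorem summable_disc {r : ℕ} (hr : 2 ≤ r) {M : ℝ} {c : ℕ → ℝ} (hc : ∀ i, |c i| ≤ M) :
    Summable fun i => c i / (r : ℝ) ^ i := by
  have hr' : (2 : ℝ) ≤ r := by exact_mod_cast hr
  have h : Summable fun i : ℕ => M * ((r : ℝ)⁻¹) ^ i :=
    (summable_geometric_of_lt_one (by positivity) (inv_lt_one_of_one_lt₀ (by linarith))).mul_left M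
  refine Summable.of_norm_bounded h fun i => ?_
  rw [Real.norm_eq_abs, abs_div, abs_of_pos (by positivity : (0 : ℝ) < (r : ℝ) ^ i), inv_pow,
    ← div_eq_mul_inv]
  gcongr
  exact hc i

theorem abs_tsum_le {r : ℕ} (hr : 2 ≤ r) {M : ℝ} {c : ℕ → ℝ} (hc : ∀ i, |c i| ≤ M) :
    |∑' i, c i / (r : ℝ) ^ i| ≤ 2 * M := by
  have hr' : (2 : ℝ) ≤ r := by exact_mod_cast hr
  have hM : 0 ≤ M := (abs_nonneg _).trans (hc 0)
  have hinv : (r : ℝ)⁻¹ ≤ 1 / 2 := by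
    rw [one_div]; exact inv_anti₀ (by norm_num) hr'
  have h : HasSum (fun i : ℕ => M * ((r : ℝ)⁻¹) ^ i) (M * (1 - (r : ℝ)⁻¹)⁻¹) :=
    (hasSum_geometric_of_lt_one (by positivity) (by linarith)).mul_left M
  have := tsum_of_norm_bounded h (f := fun i => c i / (r : ℝ) ^ i) fun i => by
    rw [Real.norm_eq_abs, abs_div, abs_of_pos (by positivity : (0 : ℝ) < (r : ℝ) ^ i), inv_pow,
      ← div_eq_mul_inv]
    gcongr
    exact hc i
  rw [Real.norm_eq_abs] at this
  refine this.trans ?_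
  rw [mul_comm]
  gcongr
  rw [inv_le_comm₀ (by linarith) (by norm_num)]
  linarith

/-- The tail of a bounded discounted sum is geometrically small. -/
theorem abs_tsum_sub_sum_le {r : ℕ} (hr : 2 ≤ r) {M : ℝ} {c : ℕ → ℝ} (hc : ∀ i, |c i| ≤ M)
    (n : ℕ) :
    |∑' i, c i / (r : ℝ) ^ i - ∑ i ∈ Finset.range n, c i / (r : ℝ) ^ i| ≤ 2 * M / (r : ℝ) ^ n := by
  have hr' : (2 : ℝ) ≤ r := by exact_mod_cast hr
  rw [← (summable_disc hr hc).sum_add_tsum_nat_add n, add_sub_cancel_left]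
  have : ∀ i, c (i + n) / (r : ℝ) ^ (i + n) = c (i + n) / (r : ℝ) ^ i / (r : ℝ) ^ n := by
    intro i; rw [pow_add, div_div]
  simp_rw [this]
  rw [tsum_div_const, abs_div, abs_of_pos (by positivity : (0 : ℝ) < (r : ℝ) ^ n)]
  gcongr
  exact abs_tsum_le hr fun i => hc (i + n)

theorem abs_disc_sub_discPrefix_le {r : ℕ} (hr : 2 ≤ r) {M : ℕ} {c : ℕ → ℤ} (hc : ∀ i, |c i| ≤ M)
    (n : ℕ) : |disc r c - discPrefix r c n| ≤ 2 * M / (r : ℝ) ^ n :=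
  abs_tsum_sub_sum_le (c := fun i => (c i : ℝ)) hr (fun i => by exact_mod_cast hc i) n

theorem tendsto_pow_inv {r : ℕ} (hr : 2 ≤ r) (C : ℝ) :
    Filter.Tendsto (fun n : ℕ => C / (r : ℝ) ^ n) Filter.atTop (nhds 0) := by
  have hr' : (1 : ℝ) < r := by exact_mod_cast (show 1 < r by omega)
  exact Filter.Tendsto.const_div_atTop (tendsto_pow_atTop_atTop_of_one_lt hr') C

theorem tendsto_discPrefix {r : ℕ} (hr : 2 ≤ r) {M : ℕ} {c : ℕ → ℤ} (hc : ∀ i, |c i| ≤ M) :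
    Filter.Tendsto (discPrefix r c) Filter.atTop (nhds (disc r c)) :=
  (summable_disc (c := fun i => (c i : ℝ)) (M := M) hr
    (fun i => by exact_mod_cast hc i)).hasSum.tendsto_sum_nat

theorem discPrefix_congr {r : ℕ} {c d : ℕ → ℤ} {n : ℕ} (h : ∀ i < n, c i = d i) :
    discPrefix r c n = discPrefix r d n :=
  Finset.sum_congr rfl fun i hi => by rw [h i (Finset.mem_range.1 hi)]

/-- A discounted sum of `n` integers is an integer multiple of `r ^ (-n)`. -/
theorem exists_int_discPrefix {r : ℕ} (hr : 2 ≤ r) (c : ℕ → ℤ) (n : ℕ) :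
    ∃ z : ℤ, discPrefix r c n * (r : ℝ) ^ n = z := by
  have hr' : (r : ℝ) ≠ 0 := by exact_mod_cast (show r ≠ 0 by omega)
  refine ⟨∑ i ∈ Finset.range n, c i * r ^ (n - i), ?_⟩
  push_cast
  rw [discPrefix, Finset.sum_mul]
  refine Finset.sum_congr rfl fun i hi => ?_
  rw [← Nat.sub_add_cancel (Finset.mem_range.1 hi).le, pow_add]
  field_simp
  simp

/-! ### Optimal discounted costs: existence, size and denominators. -/

section Bellman

/-- The Bellman equation for the least discounted cost over the allowed letters. -/
theorem exists_bellman [Finite S] [Finite Sig] (step : S → Sig → S) (c : S → Sig → ℤ) {r : ℕ}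
    (hr : 2 ≤ r) (E : S → Set Sig) (hE : ∀ s, (E s).Nonempty) :
    ∃ m : S → ℝ, (∀ s, ∀ a ∈ E s, m s ≤ c s a + m (step s a) / r) ∧
      ∀ s, ∃ a ∈ E s, m s = c s a + m (step s a) / r := by
  have := Fintype.ofFinite S
  have hr' : (2 : ℝ) ≤ r := by exact_mod_cast hr
  have hmin : ∀ (m : S → ℝ) (s : S), ∃ y : ℝ, (∀ a ∈ E s, y ≤ c s a + m (step s a) / r) ∧
      ∃ a ∈ E s, y = c s a + m (step s a) / r := by
    intro m s
    obtain ⟨a, ha, h⟩ := Set.exists_min_image (E s) (fun a => c s a + m (step s a) / r)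
      (Set.toFinite _) (hE s)
    exact ⟨_, h, a, ha, rfl⟩
  choose T hT₁ hT₂ using hmin
  have hle : ∀ m m' s, T m s ≤ T m' s + dist m m' / 2 := by
    intro m m' s
    obtain ⟨a, ha, h⟩ := hT₂ m' s
    have h1 := hT₁ m s a ha
    have h2 : m (step s a) - m' (step s a) ≤ dist m m' :=
      (le_abs_self _).trans (dist_le_pi_dist m m' (step s a))
    have h3 : (m (step s a) - m' (step s a)) / r ≤ dist m m' / 2 :=
      (div_le_div_of_nonneg_right h2 (by positivity)).trans
        (div_le_div_of_nonneg_left dist_nonneg (by norm_num) hr')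
    rw [sub_div] at h3
    linarith
  -- The Bellman operator `T` contracts the sup distance by `1 / r ≤ 1 / 2`; its fixed point is the
  -- solution.
  have hcontr : ContractingWith (1 / 2) T := by
    refine ⟨by rw [← NNReal.coe_lt_coe]; norm_num, LipschitzWith.of_dist_le_mul fun m m' => ?_⟩
    refine (dist_pi_le_iff (by positivity)).2 fun s => ?_
    rw [Real.dist_eq, abs_le]
    have h1 := hle m m' s
    have h2 := hle m' m s
    rw [dist_comm] at h2
    push_cast
    constructor <;> linarith
  refine ⟨ContractingWith.fixedPoint T hcontr, fun s a ha => ?_, fun s => ?_⟩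
  · have h := hT₁ (ContractingWith.fixedPoint T hcontr) s a ha
    rwa [hcontr.fixedPoint_isFixedPt.eq] at h
  · obtain ⟨a, ha, h⟩ := hT₂ (ContractingWith.fixedPoint T hcontr) s
    exact ⟨a, ha, by rwa [hcontr.fixedPoint_isFixedPt.eq] at h⟩

/-- At a state where `|m|` is largest, the equation gives `|m| ≤ M + |m| / 2`. -/
theorem abs_bellman_le [Finite S] {step : S → Sig → S} {c : S → Sig → ℤ} {r M : ℕ} (hr : 2 ≤ r)
    (hM : ∀ s a, |c s a| ≤ M) {m : S → ℝ}
    (hm : ∀ s, ∃ a, m s = c s a + m (step s a) / r) (s : S) : |m s| ≤ 2 * M := by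
  have hr' : (2 : ℝ) ≤ r := by exact_mod_cast hr
  have : Nonempty S := ⟨s⟩
  obtain ⟨t, ht⟩ := Finite.exists_max fun s => |m s|
  obtain ⟨a, ha⟩ := hm t
  have h1 : |(c t a : ℝ)| ≤ M := by exact_mod_cast hM t a
  have h2 : |m (step t a) / r| ≤ |m t| / 2 := by
    rw [abs_div, Nat.abs_cast]
    exact (div_le_div_of_nonneg_right (ht _) (by positivity)).trans
      (div_le_div_of_nonneg_left (abs_nonneg _) (by norm_num) hr')
  have h3 : |m t| ≤ |(c t a : ℝ)| + |m (step t a) / r| := by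
    conv_lhs => rw [ha]
    exact abs_add_le _ _
  linarith [ht s]

/-- The solutions of the Bellman equation have a common denominator. -/
theorem exists_int_bellman [Fintype S] {step : S → Sig → S} {c : S → Sig → ℤ} {r L K : ℕ} (hr : 2 ≤ r)
    (hL : r ≤ L) (hK : Fintype.card S ≤ K) {m : S → ℝ}
    (hm : ∀ s, ∃ a, m s = c s a + m (step s a) / r) (s : S) :
    ∃ z : ℤ, m s * ((L ^ K).factorial : ℝ) = z := by
  have hr' : (r : ℝ) ≠ 0 := by exact_mod_cast (show r ≠ 0 by omega)
  choose f hf using hm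
  set g : S → S := fun s => step s (f s) with hg
  -- Unfolding the equation `n` times along the optimal choices `f` leaves only integer costs.
  have hiter : ∀ n : ℕ, ∃ z : ℤ, (r : ℝ) ^ n * m s - m (g^[n] s) = z := by
    intro n
    induction n with
    | zero => exact ⟨0, by simp⟩
    | succ n ih =>
      obtain ⟨z, hz⟩ := ih
      refine ⟨r * z + r * c (g^[n] s) (f (g^[n] s)), ?_⟩
      have h := hf (g^[n] s)
      rw [Function.iterate_succ_apply']
      have h' : (r : ℝ) * m (g^[n] s) = r * c (g^[n] s) (f (g^[n] s)) + m (g (g^[n] s)) := by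
        rw [h]
        field_simp
        rfl
      push_cast
      rw [← hz, pow_succ]
      linear_combination h'
  -- The optimal path revisits a state. Subtracting the two relations shows that `(r ^ j - r ^ i) *
  -- m s` is an integer, and the positive factor `r ^ j - r ^ i ≤ L ^ K` divides `(L ^ K)!`.
  obtain ⟨i, j, hij, hjK, heq⟩ : ∃ i j : ℕ, i < j ∧ j ≤ K ∧ g^[i] s = g^[j] s := by
    have : ¬ Function.Injective fun i : Fin (K + 1) => g^[(i : ℕ)] s := by
      intro h
      have := Fintype.card_le_of_injective _ h
      simp at this
      omega
    simp only [Function.Injective, not_forall] at this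
    obtain ⟨i, j, h, hne⟩ := this
    rcases lt_or_gt_of_ne hne with h' | h'
    · exact ⟨i, j, h', by omega, h⟩
    · exact ⟨j, i, h', by omega, h.symm⟩
  obtain ⟨zi, hzi⟩ := hiter i
  obtain ⟨zj, hzj⟩ := hiter j
  rw [heq] at hzi
  have hpow : r ^ i < r ^ j := Nat.pow_lt_pow_right (by omega) hij
  have hdvd : r ^ j - r ^ i ∣ (L ^ K).factorial := by
    refine Nat.dvd_factorial (by omega) ((Nat.sub_le _ _).trans ?_)
    exact (Nat.pow_le_pow_left hL j).trans (Nat.pow_le_pow_right (by omega) hjK)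
  obtain ⟨d, hd⟩ := hdvd
  refine ⟨(zj - zi) * d, ?_⟩
  rw [hd]
  push_cast [Nat.cast_sub hpow.le]
  rw [← hzi, ← hzj]
  ring

end Bellman

end DiscountedSystem

/-! ### Splicing words, and words whose transitions obey a local condition. -/

namespace DiscountedSystem

variable {S Sig : Type}

/-- The word that agrees with `w` on the first `n` letters and continues with `t`. -/
def splice (n : ℕ) (w t : ℕ → Sig) (i : ℕ) : Sig := if i < n then w i else t (i - n)

theorem splice_of_lt {n i : ℕ} (w t : ℕ → Sig) (h : i < n) : splice n w t i = w i := if_pos h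

theorem splice_add (n i : ℕ) (w t : ℕ → Sig) : splice n w t (n + i) = t i := by
  simp [splice]

theorem stateAt_congr {step : S → Sig → S} {s : S} {w w' : ℕ → Sig} {n : ℕ}
    (h : ∀ i < n, w i = w' i) : stateAt step s w n = stateAt step s w' n := by
  induction n with
  | zero => rfl
  | succ n ih => rw [stateAt, stateAt, ih fun i hi => h i (by omega), h n (by omega)]

theorem costAt_congr {step : S → Sig → S} {c : S → Sig → ℤ} {s : S} {w w' : ℕ → Sig} {n : ℕ}
    (h : ∀ i ≤ n, w i = w' i) : costAt step c s w n = costAt step c s w' n := by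
  rw [costAt, costAt, stateAt_congr fun i hi => h i hi.le, h n le_rfl]

theorem stateAt_add (step : S → Sig → S) (s : S) (w : ℕ → Sig) (n k : ℕ) :
    stateAt step s w (n + k) = stateAt step (stateAt step s w n) (fun i => w (n + i)) k := by
  induction k with
  | zero => rfl
  | succ k ih => rw [← add_assoc, stateAt, stateAt, ih]

theorem stateAt_splice_add (step : S → Sig → S) (s : S) (w t : ℕ → Sig) (n k : ℕ) :
    stateAt step s (splice n w t) (n + k) = stateAt step (stateAt step s w n) t k := by
  rw [stateAt_add, stateAt_congr fun i hi => splice_of_lt w t hi]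
  exact stateAt_congr fun i _ => splice_add n i w t

theorem stateAt_eq_of_absorbing {step : S → Sig → S} {s z : S} (hz : ∀ a, step z a = z)
    {w : ℕ → Sig} {n k : ℕ} (hn : stateAt step s w n = z) (hk : n ≤ k) :
    stateAt step s w k = z := by
  induction k, hk using Nat.le_induction with
  | base => exact hn
  | succ k _ ih => rw [stateAt, ih, hz]

/-- All transitions on the word `w` from `s` satisfy `P`. -/
def Follows (step : S → Sig → S) (P : S → Sig → Prop) (s : S) (w : ℕ → Sig) : Prop :=
  ∀ n, P (stateAt step s w n) (w n)

theorem exists_follows {step : S → Sig → S} {P : S → Sig → Prop} (hP : ∀ s, ∃ a, P s a) (s : S) :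
    ∃ w, Follows step P s w := by
  choose f hf using hP
  have h : ∀ n, stateAt step s (fun n => f ((fun t => step t (f t))^[n] s)) n =
      (fun t => step t (f t))^[n] s := by
    intro n
    induction n with
    | zero => rfl
    | succ n ih => rw [stateAt, ih, Function.iterate_succ_apply']
  exact ⟨fun n => f ((fun t => step t (f t))^[n] s), fun n => by rw [h]; exact hf _⟩

theorem Follows.drop {step : S → Sig → S} {P : S → Sig → Prop} {s : S} {w : ℕ → Sig}
    (h : Follows step P s w) (n : ℕ) :
    Follows step P (stateAt step s w n) fun i => w (n + i) := fun k => by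
  rw [← stateAt_add]
  exact h (n + k)

theorem Follows.splice {step : S → Sig → S} {P : S → Sig → Prop} {s : S} {w t : ℕ → Sig} {n : ℕ}
    (h : Follows step P s w) (ht : Follows step P (stateAt step s w n) t) :
    Follows step P s (splice n w t) := fun k => by
  rcases lt_or_ge k n with hk | hk
  · rw [splice_of_lt w t hk, stateAt_congr fun i hi => splice_of_lt w t (hi.trans hk)]
    exact h k
  · obtain ⟨j, rfl⟩ := Nat.exists_eq_add_of_le hk
    rw [stateAt_splice_add, splice_add]
    exact ht j

/-- A state that can be reached can be reached within `card S` steps. -/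
theorem exists_follows_short [Fintype S] {step : S → Sig → S} {P : S → Sig → Prop} {s z : S}
    {w : ℕ → Sig} {n : ℕ} (h : Follows step P s w) (hn : stateAt step s w n = z) :
    ∃ w', ∃ k ≤ Fintype.card S, Follows step P s w' ∧ stateAt step s w' k = z := by
  classical
  have hex : ∃ k, ∃ w', Follows step P s w' ∧ stateAt step s w' k = z := ⟨n, w, h, hn⟩
  obtain ⟨w', hw', hk⟩ := Nat.find_spec hex
  refine ⟨w', Nat.find hex, ?_, hw', hk⟩
  by_contra! hlt
  -- A shortest word reaching `z` repeats no state before `z`: a loop between positions `i` and `j`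
  -- could be cut out.
  have : ¬ Function.Injective fun i : Fin (Nat.find hex) => stateAt step s w' i := by
    intro h
    have hle := Fintype.card_le_of_injective _ h
    rw [Fintype.card_fin] at hle
    omega
  simp only [Function.Injective, not_forall] at this
  obtain ⟨i, j, hij, hne⟩ := this
  wlog hlt' : i < j generalizing i j
  · exact this j i hij.symm (Ne.symm hne) (lt_of_le_of_ne (not_lt.1 hlt') (Ne.symm hne))
  have hlt'' : (i : ℕ) < j := hlt'
  refine Nat.find_min hex (m := i + (Nat.find hex - j)) (by omega)
    ⟨DiscountedSystem.splice i w' fun k => w' (j + k), hw'.splice ?_, ?_⟩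
  · rw [hij]
    exact hw'.drop j
  · rw [stateAt_splice_add, hij, ← stateAt_add]
    rwa [show (j : ℕ) + (Nat.find hex - j) = Nat.find hex by omega]

/-! ### Lexicographic optimization of two costs, and the potential. -/

/-- After this many letters the costs with the smaller discount factor dominate. -/
def threshold (L K M : ℕ) : ℕ := L ^ 2 * ((L ^ K).factorial * (4 * M)) + 1

/-- A common denominator of the optimal values. -/
def denom (L K M : ℕ) : ℕ := (L ^ K).factorial * L.factorial ^ threshold L K M

theorem denom_pos (L K M : ℕ) : 0 < denom L K M := by
  unfold denom
  positivity

/-- Bernoulli's inequality gives `(β / α) ^ n ≥ (1 + 1 / α) ^ n ≥ 1 + n / α`, and `threshold` is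
chosen so that `n / α` exceeds `4 * M * α * (L ^ K)!`. Here `4 * M` is the largest gain in the cost
`b`, and `1 / (α * (L ^ K)!)` the least loss in the cost `a`. -/
theorem mul_pow_lt_pow_of_threshold_le {α β L K M n : ℕ} (hα : 2 ≤ α) (hαβ : α < β) (hL : β ≤ L)
    (hn : threshold L K M ≤ n) :
    4 * (M : ℝ) * (α * (L ^ K).factorial) * (α : ℝ) ^ n < (β : ℝ) ^ n := by
  have hα' : (0 : ℝ) < α := by exact_mod_cast (show 0 < α by omega)
  have h1 : 4 * M * (α * (L ^ K).factorial) * α < n := by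
    refine lt_of_lt_of_le ?_ hn
    rw [threshold, Nat.lt_succ_iff]
    calc 4 * M * (α * (L ^ K).factorial) * α = α ^ 2 * ((L ^ K).factorial * (4 * M)) := by ring
      _ ≤ _ := Nat.mul_le_mul_right _ (Nat.pow_le_pow_left (by omega) 2)
  have h2 : 4 * (M : ℝ) * (α * (L ^ K).factorial) * α < n := by exact_mod_cast h1
  have h3 : 4 * (M : ℝ) * (α * (L ^ K).factorial) < n * (1 / α) := by
    rw [mul_one_div, lt_div_iff₀ hα']
    exact h2
  have h4 := one_add_mul_le_pow (a := (1 / α : ℝ)) (by linarith [one_div_pos.2 hα']) n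
  have h5 : ((α : ℝ) * (1 + 1 / α)) ^ n ≤ (β : ℝ) ^ n := by
    refine pow_le_pow_left₀ (by positivity) ?_ n
    rw [mul_add, mul_one, mul_one_div_cancel hα'.ne']
    exact_mod_cast hαβ
  rw [mul_pow] at h5
  calc _ < (1 + n * (1 / α : ℝ)) * (α : ℝ) ^ n := by gcongr; linarith
    _ ≤ (1 + 1 / α : ℝ) ^ n * (α : ℝ) ^ n := by gcongr
    _ ≤ _ := by linarith

/-- The total value of a word for two costs that are discounted at different rates. -/
noncomputable def total (step : S → Sig → S) (a b : S → Sig → ℤ) (α β : ℕ) (s : S)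
    (w : ℕ → Sig) : ℝ :=
  disc α (costAt step a s w) + disc β (costAt step b s w)

/-- The transition is optimal for both costs, where `m` and `v` are the optimal values. -/
def Tight (step : S → Sig → S) (a b : S → Sig → ℤ) (α β : ℕ) (m v : S → ℝ) (s : S) (x : Sig) :
    Prop :=
  m s = a s x + m (step s x) / α ∧ v s = b s x + v (step s x) / β

/-- Optimal values `m` for `a`, and among the words that are optimal for `a`, optimal values `v`
for `b`. -/
structure IsLexBellman (step : S → Sig → S) (a b : S → Sig → ℤ) (α β : ℕ) (m v : S → ℝ) :
    Prop where
  fst_le : ∀ s x, m s ≤ a s x + m (step s x) / α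
  snd_le : ∀ s x, m s = a s x + m (step s x) / α → v s ≤ b s x + v (step s x) / β
  exists_tight : ∀ s, ∃ x, Tight step a b α β m v s x

theorem exists_isLexBellman [Finite S] [Finite Sig] [Nonempty Sig] (step : S → Sig → S)
    (a b : S → Sig → ℤ) {α β : ℕ} (hα : 2 ≤ α) (hβ : 2 ≤ β) :
    ∃ m v, IsLexBellman step a b α β m v := by
  obtain ⟨m, hm₁, hm₂⟩ := exists_bellman step a hα (fun _ => Set.univ) fun _ => Set.univ_nonempty
  -- The second equation admits only the letters that are optimal for `a`.
  obtain ⟨v, hv₁, hv₂⟩ := exists_bellman step b hβ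
    (fun s => {x | m s = a s x + m (step s x) / α})
    fun s => (hm₂ s).imp fun _ h => h.2
  exact ⟨m, v, fun s x => hm₁ s x trivial, fun s x h => hv₁ s x h,
    fun s => (hv₂ s).imp fun _ h => h⟩

/-- The value of the first `n` letters, continued optimally. -/
noncomputable def potential (step : S → Sig → S) (a b : S → Sig → ℤ) (α β : ℕ) (m v : S → ℝ)
    (s : S) (w : ℕ → Sig) (n : ℕ) : ℝ :=
  discPrefix α (costAt step a s w) n + discPrefix β (costAt step b s w) n +
    (m (stateAt step s w n) / (α : ℝ) ^ n + v (stateAt step s w n) / (β : ℝ) ^ n)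

/-- The increment is the discounted sum of the defects in the two Bellman equations; it vanishes on
tight transitions. -/
theorem potential_succ (step : S → Sig → S) (a b : S → Sig → ℤ) {α β : ℕ} (hα : 2 ≤ α)
    (hβ : 2 ≤ β) (m v : S → ℝ) (s : S) (w : ℕ → Sig) (n : ℕ) :
    potential step a b α β m v s w (n + 1) = potential step a b α β m v s w n +
      ((a (stateAt step s w n) (w n) + m (stateAt step s w (n + 1)) / α - m (stateAt step s w n)) /
        (α : ℝ) ^ n +
      (b (stateAt step s w n) (w n) + v (stateAt step s w (n + 1)) / β - v (stateAt step s w n)) /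
        (β : ℝ) ^ n) := by
  have hα' : (α : ℝ) ≠ 0 := by exact_mod_cast (show α ≠ 0 by omega)
  have hβ' : (β : ℝ) ≠ 0 := by exact_mod_cast (show β ≠ 0 by omega)
  simp only [potential, discPrefix, Finset.sum_range_succ, costAt, pow_succ]
  field_simp
  ring

theorem potential_congr {step : S → Sig → S} {a b : S → Sig → ℤ} {α β : ℕ} {m v : S → ℝ} {s : S}
    {w w' : ℕ → Sig} {n : ℕ} (h : ∀ i < n, w i = w' i) :
    potential step a b α β m v s w n = potential step a b α β m v s w' n := by
  have hc : ∀ c : S → Sig → ℤ, ∀ i < n, costAt step c s w i = costAt step c s w' i :=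
    fun c i hi => costAt_congr fun j hj => h j (by omega)
  rw [potential, potential, discPrefix_congr (hc a), discPrefix_congr (hc b), stateAt_congr h]

/-! ### The improvement of a word beyond the threshold. -/

section Core

variable [Fintype S] {step : S → Sig → S} {a b : S → Sig → ℤ} {α β L K M : ℕ} {m v : S → ℝ}

theorem tendsto_potential (hα : 2 ≤ α) (hβ : 2 ≤ β) (ha : ∀ s x, |a s x| ≤ M)
    (hb : ∀ s x, |b s x| ≤ M) (s : S) (w : ℕ → Sig) :
    Filter.Tendsto (potential step a b α β m v s w) Filter.atTop
      (nhds (total step a b α β s w)) := by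
  have hlim : ∀ (r : ℕ), 2 ≤ r → ∀ u : S → ℝ, Filter.Tendsto
      (fun n => u (stateAt step s w n) / (r : ℝ) ^ n) Filter.atTop (nhds 0) := by
    intro r hr u
    obtain ⟨C, hC⟩ := (Set.toFinite (Set.range fun t => |u t|)).bddAbove
    refine squeeze_zero_norm (fun n => ?_) (tendsto_pow_inv hr C)
    rw [Real.norm_eq_abs, abs_div, abs_of_nonneg (by positivity : (0 : ℝ) ≤ (r : ℝ) ^ n)]
    gcongr
    exact hC ⟨_, rfl⟩
  have h := ((tendsto_discPrefix hα (c := costAt step a s w) fun i => ha _ _).add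
    (tendsto_discPrefix hβ (c := costAt step b s w) fun i => hb _ _)).add
    ((hlim α hα m).add (hlim β hβ v))
  rw [add_zero, add_zero] at h
  exact h

theorem IsLexBellman.abs_fst_le (h : IsLexBellman step a b α β m v) (hα : 2 ≤ α)
    (ha : ∀ s x, |a s x| ≤ M) (s : S) : |m s| ≤ 2 * M :=
  abs_bellman_le hα ha (fun s => (h.exists_tight s).imp fun _ h => h.1) s

theorem IsLexBellman.abs_snd_le (h : IsLexBellman step a b α β m v) (hβ : 2 ≤ β)
    (hb : ∀ s x, |b s x| ≤ M) (s : S) : |v s| ≤ 2 * M :=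
  abs_bellman_le hβ hb (fun s => (h.exists_tight s).imp fun _ h => h.2) s

/-- Beyond the threshold a transition can lower the potential in no case, and it keeps the
potential only if it is tight. -/
theorem IsLexBellman.loss_nonneg (h : IsLexBellman step a b α β m v) (hα : 2 ≤ α) (hαβ : α < β)
    (hL : β ≤ L) (hK : Fintype.card S ≤ K) (hb : ∀ s x, |b s x| ≤ M)
    {n : ℕ} (hn : threshold L K M ≤ n) (s : S) (x : Sig) :
    0 ≤ (a s x + m (step s x) / α - m s) / (α : ℝ) ^ n +
        (b s x + v (step s x) / β - v s) / (β : ℝ) ^ n ∧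
      ((a s x + m (step s x) / α - m s) / (α : ℝ) ^ n +
        (b s x + v (step s x) / β - v s) / (β : ℝ) ^ n = 0 → Tight step a b α β m v s x) := by
  have hα' : (0 : ℝ) < α := by exact_mod_cast (show 0 < α by omega)
  have hβ' : (2 : ℝ) ≤ β := by exact_mod_cast (show 2 ≤ β by omega)
  -- A letter that is optimal for `a` leaves only the defect in `b`, which `snd_le` makes
  -- nonnegative. Any other letter loses enough in `a` to outweigh `b`.
  by_cases hs : m s = a s x + m (step s x) / α
  · have h1 := h.snd_le s x hs
    rw [show a s x + m (step s x) / α - m s = 0 by linarith, zero_div, zero_add]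
    refine ⟨div_nonneg (by linarith) (by positivity), fun h0 => ⟨hs, ?_⟩⟩
    rcases div_eq_zero_iff.1 h0 with h0 | h0
    · linarith
    · exact absurd h0 (by positivity)
  · have hint := fun s => exists_int_bellman hα (hαβ.le.trans hL) hK (c := a) (m := m)
      (fun s => (h.exists_tight s).imp fun _ h => h.1) s
    obtain ⟨z₁, hz₁⟩ := hint s
    obtain ⟨z₂, hz₂⟩ := hint (step s x)
    set h₀ : ℕ := (L ^ K).factorial
    have hh₀' : (0 : ℝ) < h₀ := by exact_mod_cast (L ^ K).factorial_pos
    set l : ℝ := a s x + m (step s x) / α - m s with hl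
    have hlpos : 0 < l := by
      have := lt_of_le_of_ne (h.fst_le s x) hs
      rw [hl]
      linarith
    have hlint : l * (α * h₀) = ((α * h₀ * a s x + z₂ - α * z₁ : ℤ) : ℝ) := by
      push_cast
      rw [← hz₁, ← hz₂, hl]
      field_simp
    -- The defect `l` is positive and has denominator `α * h₀`, so it cannot be smaller than `1 / (α
    -- * h₀)`.
    have hl1 : 1 ≤ l * (α * h₀) := by
      have h2 : 0 < l * (α * h₀) := by positivity
      rw [hlint] at h2 ⊢
      exact_mod_cast h2
    -- The three summands contribute at most `M`, `2 * M / β ≤ M` and `2 * M`.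
    have hbnd : -(4 * M : ℝ) ≤ b s x + v (step s x) / β - v s := by
      have h1 : |(b s x : ℝ)| ≤ M := by exact_mod_cast hb s x
      have h2 := h.abs_snd_le (by omega) hb s
      have h3 := h.abs_snd_le (by omega) hb (step s x)
      have h4 : |v (step s x) / β| ≤ M := by
        rw [abs_div, Nat.abs_cast, div_le_iff₀ (by linarith)]
        nlinarith [(Nat.cast_nonneg M : (0 : ℝ) ≤ M)]
      rw [abs_le] at h1 h2 h4
      linarith [h1.1, h2.2, h4.1]
    have hnum := mul_pow_lt_pow_of_threshold_le (K := K) hα hαβ hL hn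
    have hpos : 0 < l / (α : ℝ) ^ n + (b s x + v (step s x) / β - v s) / (β : ℝ) ^ n := by
      have h1 : -(4 * M : ℝ) / (β : ℝ) ^ n ≤ (b s x + v (step s x) / β - v s) / (β : ℝ) ^ n := by
        gcongr
      have h2 : 4 * (M : ℝ) / (β : ℝ) ^ n < l / (α : ℝ) ^ n := by
        rw [div_lt_div_iff₀ (by positivity) (by positivity)]
        have h3 : 4 * (M : ℝ) * (α * h₀) * (α : ℝ) ^ n < l * (α * h₀) * (β : ℝ) ^ n :=
          hnum.trans_le (le_mul_of_one_le_left (by positivity) hl1)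
        have h5 : 4 * (M : ℝ) * (α : ℝ) ^ n * (α * h₀) < l * (β : ℝ) ^ n * (α * h₀) := by
          linarith
        exact lt_of_mul_lt_mul_right h5 (by positivity)
      rw [neg_div] at h1
      linarith
    exact ⟨hpos.le, fun h0 => absurd h0 hpos.ne'⟩

/-- The prefix contributes denominators `α ^ N` and `β ^ N`, which divide `L! ^ N`; the optimal
values contribute `(L ^ K)!`. -/
theorem IsLexBellman.exists_int_potential (h : IsLexBellman step a b α β m v) (hα : 2 ≤ α)
    (hβ : 2 ≤ β) (hαL : α ≤ L) (hβL : β ≤ L) (hK : Fintype.card S ≤ K) (s : S) (w : ℕ → Sig) :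
    ∃ z : ℤ, potential step a b α β m v s w (threshold L K M) * denom L K M = z := by
  have key : ∀ (r : ℕ) (c : S → Sig → ℤ) (u : S → ℝ), 2 ≤ r → r ≤ L →
      (∀ s, ∃ x, u s = c s x + u (step s x) / r) → ∃ z : ℤ,
      (discPrefix r (costAt step c s w) (threshold L K M) +
        u (stateAt step s w (threshold L K M)) / (r : ℝ) ^ threshold L K M) * denom L K M = z := by
    intro r c u hr hrL hu
    set N := threshold L K M
    obtain ⟨z₁, hz₁⟩ := exists_int_discPrefix hr (costAt step c s w) N
    obtain ⟨z₂, hz₂⟩ := exists_int_bellman hr hrL hK hu (stateAt step s w N)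
    obtain ⟨d, hd⟩ := pow_dvd_pow_of_dvd (Nat.dvd_factorial (show 0 < r by omega) hrL) N
    have hr' : (r : ℝ) ≠ 0 := by exact_mod_cast (show r ≠ 0 by omega)
    refine ⟨z₁ * (L ^ K).factorial * d + z₂ * d, ?_⟩
    have hd' : (denom L K M : ℝ) = (L ^ K).factorial * ((r : ℝ) ^ N * d) := by
      rw [denom, hd]
      push_cast
      rfl
    rw [hd']
    push_cast
    rw [← hz₁, ← hz₂]
    field_simp
  obtain ⟨z₁, h₁⟩ := key α a m hα hαL fun s => (h.exists_tight s).imp fun _ h => h.1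
  obtain ⟨z₂, h₂⟩ := key β b v hβ hβL fun s => (h.exists_tight s).imp fun _ h => h.2
  refine ⟨z₁ + z₂, ?_⟩
  push_cast
  rw [← h₁, ← h₂, potential]
  ring

/-- A word can be improved beyond the threshold to a word whose value has a bounded denominator; if
there is no strict improvement, then an absorbing state that is reached can be reached early. -/
theorem exists_improvement_of_lt [Finite Sig] (hα : 2 ≤ α) (hαβ : α < β) (hL : β ≤ L)
    (hK : Fintype.card S ≤ K) (ha : ∀ s x, |a s x| ≤ M) (hb : ∀ s x, |b s x| ≤ M) (s z : S)
    (w : ℕ → Sig) :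
    ∃ w' : ℕ → Sig, (∀ i < threshold L K M, w' i = w i) ∧
      total step a b α β s w' ≤ total step a b α β s w ∧
      (∃ k : ℤ, total step a b α β s w' * denom L K M = k) ∧
      (total step a b α β s w' < total step a b α β s w ∨
        ((∀ x, step z x = z) → ∀ n, stateAt step s w n = z →
          stateAt step s w' (threshold L K M + K) = z)) := by
  have : Nonempty Sig := ⟨w 0⟩
  obtain ⟨m, v, h⟩ := exists_isLexBellman step a b hα (show 2 ≤ β by omega)
  set N := threshold L K M
  set Φ := potential step a b α β m v s with hΦ
  have hmono : ∀ w : ℕ → Sig, ∀ n, Φ w N ≤ Φ w (N + n) ∧ Φ w (N + n) ≤ Φ w (N + n + 1) := by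
    intro w n
    have hstep : ∀ n, Φ w (N + n) ≤ Φ w (N + n + 1) := fun n => by
      rw [hΦ, potential_succ step a b hα (by omega)]
      have := (h.loss_nonneg hα hαβ hL hK hb (n := N + n) (by omega)
        (stateAt step s w (N + n)) (w (N + n))).1
      change _ ≤ _ + (_ / _ + _ / _)
      simp only [stateAt]
      linarith
    refine ⟨?_, hstep n⟩
    induction n with
    | zero => exact le_rfl
    | succ n ih => exact ih.trans (hstep n)
  -- From `N` on the potential increases to the total value, so `Φ w N` bounds from below every
  -- continuation of the prefix of length `N`.
  have hge : ∀ w : ℕ → Sig, ∀ n, Φ w (N + n) ≤ total step a b α β s w := by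
    intro w n
    have hm : Monotone fun k => Φ w (N + k) := monotone_nat_of_le_succ fun k => (hmono w k).2
    refine hm.ge_of_tendsto ?_ n
    exact (tendsto_potential hα (by omega) ha hb s w).comp
      (Filter.tendsto_atTop_mono (fun k => Nat.le_add_left k N) Filter.tendsto_id)
  -- Tight continuations keep the potential constant and so attain this bound.
  have htight : ∀ t : ℕ → Sig, Follows step (Tight step a b α β m v) (stateAt step s w N) t →
      total step a b α β s (splice N w t) = Φ w N := by
    intro t ht
    have hconst : ∀ n, Φ (splice N w t) (N + n) = Φ w N := by
      intro n
      induction n with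
      | zero => exact potential_congr fun i hi => splice_of_lt w t hi
      | succ n ih =>
        rw [← add_assoc, hΦ, potential_succ step a b hα (by omega), ← hΦ, ih, stateAt,
          stateAt_splice_add, splice_add]
        rw [← (ht n).1, ← (ht n).2]
        simp
    refine tendsto_nhds_unique ((tendsto_potential (m := m) (v := v) hα (by omega) ha hb s
      (splice N w t)).comp
      (Filter.tendsto_atTop_mono (fun k => Nat.le_add_left k N) Filter.tendsto_id)) ?_
    refine tendsto_const_nhds.congr fun n => ?_
    exact (hconst n).symm
  have hint := h.exists_int_potential (M := M) hα (show 2 ≤ β by omega) (by omega) hL hK s w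
  obtain ⟨t, ht⟩ := exists_follows (step := step) h.exists_tight (stateAt step s w N)
  by_cases hlt : Φ w N < total step a b α β s w
  · refine ⟨splice N w t, fun i hi => splice_of_lt w t hi, ?_, ?_, Or.inl ?_⟩ <;> rw [htight t ht]
    · exact hlt.le
    · exact hint
    · exact hlt
  have heq : Φ w N = total step a b α β s w := le_antisymm (hge w 0) (not_lt.1 hlt)
  by_cases hreach : (∀ x, step z x = z) ∧ ∃ n, stateAt step s w n = z
  · obtain ⟨hz, n, hn⟩ := hreach
    -- Without strict improvement the potential of `w` is constant from `N` on, so all its later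
    -- transitions are tight. A shortest tight path to `z` then costs the same.
    have hfol : Follows step (Tight step a b α β m v) (stateAt step s w N) fun i => w (N + i) := by
      intro k
      rw [← stateAt_add]
      refine (h.loss_nonneg hα hαβ hL hK hb (n := N + k) (by omega) _ _).2 ?_
      have h1 := potential_succ step a b hα (show 2 ≤ β by omega) m v s w (N + k)
      rw [← hΦ] at h1
      have h2 := hge w (k + 1)
      rw [← add_assoc] at h2
      have h3 := (hmono w k).1
      have h4 := (hmono w k).2
      simp only [stateAt] at h1
      linarith
    have hnz : stateAt step (stateAt step s w N) (fun i => w (N + i)) n = z := by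
      rw [← stateAt_add]
      exact stateAt_eq_of_absorbing hz hn (by omega)
    obtain ⟨t', k, hk, ht', hkz⟩ := exists_follows_short hfol hnz
    refine ⟨splice N w t', fun i hi => splice_of_lt w t' hi, ?_, ?_, Or.inr fun _ _ _ => ?_⟩
    · rw [htight t' ht', heq]
    · rw [htight t' ht']
      exact hint
    · rw [stateAt_splice_add]
      exact stateAt_eq_of_absorbing hz hkz (hk.trans hK)
  · refine ⟨splice N w t, fun i hi => splice_of_lt w t hi, ?_, ?_, Or.inr fun hz n hn => ?_⟩
    · rw [htight t ht, heq]
    · rw [htight t ht]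
      exact hint
    · exact absurd ⟨hz, n, hn⟩ hreach

end Core

end DiscountedSystem

/-! ### The horizon at which the sign of the values is visible. -/

namespace DiscountedSystem

variable {S Sig : Type}

/-- The bounds on a deterministic system with two discounted costs that determine how long the
words are that have to be examined. -/
structure IsBounded [Fintype S] (a b : S → Sig → ℤ) (α β L K M : ℕ) : Prop where
  two_le_fst : 2 ≤ α
  two_le_snd : 2 ≤ β
  fst_lt : α < L
  snd_lt : β < L
  card_lt : Fintype.card S < K
  cost_le : ∀ s x, |a s x| + |b s x| ≤ M

/-- The words of this length determine the answers to the comparison problems. -/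
def horizon (L K M : ℕ) : ℕ := 8 * M * denom L K M + threshold L K M + K + 1

/-- The total value of the first `n` letters. -/
noncomputable def prefixTotal (step : S → Sig → S) (a b : S → Sig → ℤ) (α β : ℕ) (s : S)
    (w : ℕ → Sig) (n : ℕ) : ℝ :=
  discPrefix α (costAt step a s w) n + discPrefix β (costAt step b s w) n

section Bounds

variable {step : S → Sig → S} {a b : S → Sig → ℤ} {α β L K M : ℕ}

theorem IsBounded.abs_fst_le [Fintype S] (h : IsBounded a b α β L K M) (s : S) (x : Sig) : |a s x| ≤ M :=
  (le_add_of_nonneg_right (abs_nonneg _)).trans (h.cost_le s x)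

theorem IsBounded.abs_snd_le [Fintype S] (h : IsBounded a b α β L K M) (s : S) (x : Sig) : |b s x| ≤ M :=
  (le_add_of_nonneg_left (abs_nonneg _)).trans (h.cost_le s x)

/-- Reduces equal discount factors to distinct ones. The factor `α + 1` of the zero cost is
arbitrary apart from being larger than `α`; this is why `IsBounded` asks for `α < L` and bounds the
sum `|a| + |b|`. -/
theorem total_eq_of_eq (hα : 2 ≤ α) (ha : ∀ s x, |a s x| ≤ M) (hb : ∀ s x, |b s x| ≤ M) (s : S)
    (w : ℕ → Sig) :
    total step a b α α s w = total step (fun s x => a s x + b s x) (fun _ _ => 0) α (α + 1) s w := by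
  have h1 := summable_disc (c := fun i => (costAt step a s w i : ℝ)) (M := M) hα
    fun i => by exact_mod_cast ha _ _
  have h2 := summable_disc (c := fun i => (costAt step b s w i : ℝ)) (M := M) hα
    fun i => by exact_mod_cast hb _ _
  simp only [total, disc]
  rw [← h1.tsum_add h2]
  simp [costAt, add_div]

theorem IsBounded.exists_improvement [Finite Sig] [Fintype S] (h : IsBounded a b α β L K M) (s z : S)
    (w : ℕ → Sig) :
    ∃ w' : ℕ → Sig, (∀ i < threshold L K M, w' i = w i) ∧
      total step a b α β s w' ≤ total step a b α β s w ∧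
      (∃ k : ℤ, total step a b α β s w' * denom L K M = k) ∧
      (total step a b α β s w' < total step a b α β s w ∨
        ((∀ x, step z x = z) → ∀ n, stateAt step s w n = z →
          stateAt step s w' (threshold L K M + K) = z)) := by
  have hα := h.two_le_fst
  have hβ := h.two_le_snd
  rcases lt_trichotomy α β with hlt | rfl | hlt
  · exact exists_improvement_of_lt hα hlt h.snd_lt.le h.card_lt.le h.abs_fst_le h.abs_snd_le s z w
  · simp only [total_eq_of_eq hα h.abs_fst_le h.abs_snd_le]
    exact exists_improvement_of_lt hα (Nat.lt_succ_self α) h.fst_lt h.card_lt.le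
      (fun s x => (abs_add_le _ _).trans (h.cost_le s x)) (by simp) s z w
  · have hswap : ∀ w, total step a b α β s w = total step b a β α s w := fun w => add_comm _ _
    simp only [hswap]
    exact exists_improvement_of_lt hβ hlt h.fst_lt.le h.card_lt.le h.abs_snd_le h.abs_fst_le s z w

theorem IsBounded.abs_total_sub_le [Fintype S] (h : IsBounded a b α β L K M) (s : S) (w : ℕ → Sig) (n : ℕ) :
    |total step a b α β s w - prefixTotal step a b α β s w n| ≤
      2 * M / (α : ℝ) ^ n + 2 * M / (β : ℝ) ^ n := by
  have h1 := abs_disc_sub_discPrefix_le h.two_le_fst (M := M) (c := costAt step a s w)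
    (fun i => h.abs_fst_le _ _) n
  have h2 := abs_disc_sub_discPrefix_le h.two_le_snd (M := M) (c := costAt step b s w)
    (fun i => h.abs_snd_le _ _) n
  rw [total, prefixTotal, add_sub_add_comm]
  exact (abs_add_le _ _).trans (add_le_add h1 h2)

/-- Both tails are at most `2 * M / 2 ^ N`, and `8 * M * denom < N < 2 ^ N` for the horizon `N`. The
factor `2` covers the error of the prefix and the slack in the tests below. -/
theorem IsBounded.two_mul_tail_lt [Fintype S] (h : IsBounded a b α β L K M) :
    2 * (2 * M / (α : ℝ) ^ horizon L K M + 2 * M / (β : ℝ) ^ horizon L K M) <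
      1 / denom L K M := by
  have hα : (2 : ℝ) ≤ α := by exact_mod_cast h.two_le_fst
  have hβ : (2 : ℝ) ≤ β := by exact_mod_cast h.two_le_snd
  have hH : (0 : ℝ) < denom L K M := by exact_mod_cast denom_pos L K M
  set N := horizon L K M with hN
  have h1 : 2 * M / (α : ℝ) ^ N ≤ 2 * M / (2 : ℝ) ^ N := by gcongr
  have h2 : 2 * M / (β : ℝ) ^ N ≤ 2 * M / (2 : ℝ) ^ N := by gcongr
  have h3 : 8 * M * denom L K M < 2 ^ N :=
    lt_of_le_of_lt (by rw [hN, horizon]; omega) N.lt_two_pow_self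
  have h4 : 8 * (M : ℝ) * denom L K M < 2 ^ N := by exact_mod_cast h3
  have h5 : 8 * M / (2 : ℝ) ^ N < 1 / denom L K M := by
    rw [div_lt_div_iff₀ (by positivity) hH]
    linarith
  have h6 : 8 * M / (2 : ℝ) ^ N = 4 * (2 * M / (2 : ℝ) ^ N) := by ring
  linarith

theorem one_div_le_of_int {x : ℝ} {H : ℕ} (hH : 0 < H) (hx : 0 < x) (h : ∃ k : ℤ, x * H = k) :
    1 / (H : ℝ) ≤ x := by
  obtain ⟨k, hk⟩ := h
  have hH' : (0 : ℝ) < H := by exact_mod_cast hH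
  rw [div_le_iff₀ hH', hk]
  have : (0 : ℝ) < k := hk ▸ mul_pos hx hH'
  exact_mod_cast this

theorem le_neg_one_div_of_int {x : ℝ} {H : ℕ} (hH : 0 < H) (hx : x < 0)
    (h : ∃ k : ℤ, x * H = k) : x ≤ -(1 / (H : ℝ)) := by
  obtain ⟨k, hk⟩ := h
  exact le_neg_of_le_neg (one_div_le_of_int hH (neg_pos.2 hx) ⟨-k, by push_cast; rw [← hk]; ring⟩)

/-- All words have a positive value if and only if this is visible at the horizon. -/
theorem IsBounded.forall_total_pos_iff [Fintype S] [Finite Sig] (h : IsBounded a b α β L K M)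
    (s : S) :
    (∀ w, 0 < total step a b α β s w) ↔
      ∀ w, 2 * M / (α : ℝ) ^ horizon L K M + 2 * M / (β : ℝ) ^ horizon L K M <
        prefixTotal step a b α β s w (horizon L K M) := by
  have hb := fun w => abs_le.1 (h.abs_total_sub_le (step := step) s w (horizon L K M))
  refine ⟨fun hpos w => ?_, fun hpre w => ?_⟩
  -- The value of `w` is at least that of `w'`, a positive multiple of `1 / denom`; this exceeds
  -- twice the tail. The absorbing state plays no role here.
  · obtain ⟨w', -, hle, hint, -⟩ := h.exists_improvement (step := step) s s w
    have h1 := one_div_le_of_int (denom_pos L K M) (hpos w') hint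
    linarith [(hb w).2, h.two_mul_tail_lt]
  · linarith [hpre w, (hb w).1]

/-- All words have a nonnegative value if and only if this is visible at the horizon. -/
theorem IsBounded.forall_total_nonneg_iff [Fintype S] [Finite Sig] (h : IsBounded a b α β L K M)
    (s : S) :
    (∀ w, 0 ≤ total step a b α β s w) ↔
      ∀ w, 0 ≤ prefixTotal step a b α β s w (horizon L K M) +
        (2 * M / (α : ℝ) ^ horizon L K M + 2 * M / (β : ℝ) ^ horizon L K M) := by
  have hb := fun w => abs_le.1 (h.abs_total_sub_le (step := step) s w (horizon L K M))
  refine ⟨fun hpos w => by linarith [hpos w, (hb w).2], fun hpre w => ?_⟩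
  by_contra! hneg
  obtain ⟨w', -, hle, hint, -⟩ := h.exists_improvement (step := step) s s w
  have h1 := le_neg_one_div_of_int (denom_pos L K M) (hle.trans_lt hneg) hint
  linarith [(hb w').1, hpre w', h.two_mul_tail_lt]

end Bounds

/-! ### Finite words as infinite words with a stop letter. -/

section Halt

/-- The system that may halt: the letter `none` leads to the absorbing state `none`. -/
def stopStep (step : S → Sig → S) : Option S → Option Sig → Option S
  | some s, some x => some (step s x)
  | _, _ => none

/-- Stopping and being stopped costs nothing. -/
def stopCost (c : S → Sig → ℤ) : Option S → Option Sig → ℤ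
  | some s, some x => c s x
  | _, _ => 0

variable {step : S → Sig → S} {a b : S → Sig → ℤ} {α β L K M : ℕ}

theorem stopStep_none_right (s : Option S) : stopStep step s (none : Option Sig) = none := by
  cases s <;> rfl

theorem stopCost_none_right (c : S → Sig → ℤ) (s : Option S) : stopCost c s none = 0 := by
  cases s <;> rfl

theorem stateAt_stopStep {W : ℕ → Option Sig} {w : ℕ → Sig} {n : ℕ}
    (h : ∀ i < n, W i = some (w i)) (s : S) :
    stateAt (stopStep step) (some s) W n = some (stateAt step s w n) := by
  induction n with
  | zero => rfl
  | succ n ih => rw [stateAt, ih fun i hi => h i (by omega), h n (by omega)]; rfl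

theorem costAt_stopStep {W : ℕ → Option Sig} {w : ℕ → Sig} {n : ℕ}
    (h : ∀ i ≤ n, W i = some (w i)) (c : S → Sig → ℤ) (s : S) :
    costAt (stopStep step) (stopCost c) (some s) W n = costAt step c s w n := by
  rw [costAt, stateAt_stopStep fun i hi => h i hi.le, h n le_rfl]
  rfl

theorem costAt_stopStep_eq_zero {W : ℕ → Option Sig} {j i : ℕ} {s : Option S}
    (hj : stateAt (stopStep step) s W j = none) (hi : j ≤ i) (c : S → Sig → ℤ) :
    costAt (stopStep step) (stopCost c) s W i = 0 := by
  rw [costAt, stateAt_eq_of_absorbing (fun x => rfl) hj hi]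
  rfl

theorem discPrefix_eq_of_zero {r : ℕ} {c : ℕ → ℤ} {j n : ℕ} (hj : j ≤ n)
    (h : ∀ i, j ≤ i → c i = 0) : discPrefix r c n = discPrefix r c j := by
  refine (Finset.sum_subset (Finset.range_mono hj) fun i _ hi => ?_).symm
  rw [h i (by simpa using hi)]
  simp

theorem disc_eq_of_zero {r : ℕ} {c : ℕ → ℤ} {j : ℕ} (h : ∀ i, j ≤ i → c i = 0) :
    disc r c = discPrefix r c j := by
  refine tsum_eq_sum fun i hi => ?_
  rw [h i (by simpa using hi)]
  simp

/-- Cutting `W` at its first `none` loses no cost, and `h0` keeps the remaining word nonempty. -/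
theorem exists_prefixTotal_eq_of_stopStep {W : ℕ → Option Sig} (h0 : W 0 ≠ none) (s : S) (n : ℕ) :
    ∃ j ≤ n, ∃ w : ℕ → Sig,
      prefixTotal (stopStep step) (stopCost a) (stopCost b) α β (some s) W (n + 1) =
        prefixTotal step a b α β s w (j + 1) := by
  classical
  obtain ⟨x₀, hx₀⟩ := Option.ne_none_iff_exists'.1 h0
  have hsome : ∀ k, (∀ i < k, W i ≠ none) → ∀ i < k, W i = some ((W i).getD x₀) := by
    intro k hk i hi
    obtain ⟨x, hx⟩ := Option.ne_none_iff_exists'.1 (hk i hi)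
    rw [hx]
    rfl
  have heq : ∀ k, (∀ i < k, W i ≠ none) →
      prefixTotal (stopStep step) (stopCost a) (stopCost b) α β (some s) W k =
        prefixTotal step a b α β s (fun i => (W i).getD x₀) k := by
    intro k hk
    have hc : ∀ c : S → Sig → ℤ, ∀ i < k, costAt (stopStep step) (stopCost c) (some s) W i =
        costAt step c s (fun i => (W i).getD x₀) i :=
      fun c i hi => costAt_stopStep (fun l hl => hsome k hk l (by omega)) c s
    rw [prefixTotal, prefixTotal, discPrefix_congr (hc a), discPrefix_congr (hc b)]
  by_cases hall : ∀ i < n + 1, W i ≠ none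
  · exact ⟨n, le_rfl, _, heq _ hall⟩
  · push Not at hall
    obtain ⟨k, hk, hWk⟩ := hall
    have hex : ∃ k, W k = none := ⟨k, hWk⟩
    have hpos : Nat.find hex ≠ 0 := fun h => h0 (h ▸ Nat.find_spec hex)
    have hle : Nat.find hex ≤ k := Nat.find_min' hex hWk
    obtain ⟨j, hj⟩ := Nat.exists_eq_succ_of_ne_zero hpos
    have hz : ∀ c : S → Sig → ℤ, ∀ i, j + 1 ≤ i →
        costAt (stopStep step) (stopCost c) (some s) W i = 0 := by
      intro c i hi
      have hWj : W (j + 1) = none := by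
        have := Nat.find_spec hex
        rwa [hj] at this
      rcases hi.eq_or_lt with rfl | hi
      · rw [costAt, hWj, stopCost_none_right]
      · refine costAt_stopStep_eq_zero (j := j + 2) ?_ hi c
        rw [stateAt, hWj, stopStep_none_right]
    refine ⟨j, by omega, fun i => (W i).getD x₀, ?_⟩
    rw [← heq (j + 1) fun i hi => Nat.find_min hex (by omega), prefixTotal, prefixTotal,
      discPrefix_eq_of_zero (by omega) (hz a), discPrefix_eq_of_zero (by omega) (hz b)]

theorem IsBounded.stopSystem [Fintype S] (h : IsBounded a b α β L K M) :
    IsBounded (stopCost a) (stopCost b) α β L (K + 1) M where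
  two_le_fst := h.two_le_fst
  two_le_snd := h.two_le_snd
  fst_lt := h.fst_lt
  snd_lt := h.snd_lt
  card_lt := by rw [Fintype.card_option]; have := h.card_lt; omega
  cost_le s x := by
    rcases s with _ | s <;> rcases x with _ | x
    · simp [stopCost]
    · simp [stopCost]
    · simp [stopCost]
    · exact h.cost_le s x

/-- A finite word of negative value (of value at most zero) can be replaced by one that is shorter
than the horizon. -/
theorem IsBounded.exists_short [Fintype S] [Finite Sig] (h : IsBounded a b α β L K M) (s : S)
    (w : ℕ → Sig) (n : ℕ) :
    (prefixTotal step a b α β s w (n + 1) < 0 → ∃ j < horizon L (K + 1) M, ∃ w',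
      prefixTotal step a b α β s w' (j + 1) < 0) ∧
    (prefixTotal step a b α β s w (n + 1) ≤ 0 → ∃ j < horizon L (K + 1) M, ∃ w',
      prefixTotal step a b α β s w' (j + 1) ≤ 0) := by
  set W : ℕ → Option Sig := fun i => if i < n + 1 then some (w i) else none with hW
  have hWs : ∀ i < n + 1, W i = some (w i) := fun i hi => if_pos hi
  have hWn : W (n + 1) = none := if_neg (lt_irrefl _)
  have hnone : stateAt (stopStep step) (some s) W (n + 2) = none := by
    rw [stateAt, hWn, stopStep_none_right]
  have hzero : ∀ c : S → Sig → ℤ, ∀ i, n + 1 ≤ i →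
      costAt (stopStep step) (stopCost c) (some s) W i = 0 := by
    intro c i hi
    rcases hi.eq_or_lt with rfl | hi
    · rw [costAt, hWn, stopCost_none_right]
    · exact costAt_stopStep_eq_zero hnone hi c
  have hcost : ∀ c : S → Sig → ℤ, ∀ i < n + 1,
      costAt (stopStep step) (stopCost c) (some s) W i = costAt step c s w i :=
    fun c i hi => costAt_stopStep (fun l hl => hWs l (by omega)) c s
  have htot : total (stopStep step) (stopCost a) (stopCost b) α β (some s) W =
      prefixTotal step a b α β s w (n + 1) := by
    rw [total, prefixTotal, disc_eq_of_zero (hzero a), disc_eq_of_zero (hzero b),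
      discPrefix_congr (hcost a), discPrefix_congr (hcost b)]
  obtain ⟨W', hagree, hle, hint, hreach⟩ :=
    h.stopSystem.exists_improvement (step := stopStep step) (some s) none W
  -- The threshold is positive, so the improved word keeps the first letter and does not stop at
  -- once.
  have hW'0 : W' 0 ≠ none := by
    rw [hagree 0 (Nat.succ_pos _), hWs 0 (Nat.succ_pos _)]
    simp
  rw [htot] at hle hreach
  have hshort : ∀ k < horizon L (K + 1) M, ∃ j < horizon L (K + 1) M, ∃ w',
      prefixTotal (stopStep step) (stopCost a) (stopCost b) α β (some s) W' (k + 1) =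
        prefixTotal step a b α β s w' (j + 1) := by
    intro k hk
    obtain ⟨j, hj, w', hw'⟩ := exists_prefixTotal_eq_of_stopStep (step := step) (a := a) (b := b)
      (α := α) (β := β) hW'0 s k
    exact ⟨j, by omega, w', hw'⟩
  -- `W'` need not stop, but a negative value is at most `-1 / denom`, so its prefix at the horizon
  -- is negative too.
  have hneg : total (stopStep step) (stopCost a) (stopCost b) α β (some s) W' < 0 →
      ∃ j < horizon L (K + 1) M, ∃ w', prefixTotal step a b α β s w' (j + 1) < 0 := by
    intro hlt
    obtain ⟨k, hk⟩ : ∃ k, horizon L (K + 1) M = k + 1 := ⟨_, rfl⟩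
    obtain ⟨j, hj, w', hw'⟩ := hshort k (by omega)
    refine ⟨j, hj, w', ?_⟩
    rw [← hw', ← hk]
    have h1 := le_neg_one_div_of_int (denom_pos _ _ _) hlt hint
    have h2 := (abs_le.1 (h.stopSystem.abs_total_sub_le (step := stopStep step) (some s) W'
      (horizon L (K + 1) M))).1
    have h3 := h.stopSystem.two_mul_tail_lt
    have h4 : 0 ≤ 2 * M / (α : ℝ) ^ horizon L (K + 1) M + 2 * M / (β : ℝ) ^ horizon L (K + 1) M := by
      positivity
    linarith
  refine ⟨fun hlt => hneg (hle.trans_lt hlt), fun hlt => ?_⟩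
  rcases hreach with hlt' | hreach
  · obtain ⟨j, hj, w', hw'⟩ := hneg (hlt'.trans_le hlt)
    exact ⟨j, hj, w', hw'.le⟩
  -- Here `W'` has stopped by position `threshold + (K + 1)`, so its total value is that of a short
  -- finite word.
  · have hnoneAt := hreach (fun _ => rfl) (n + 2) hnone
    obtain ⟨k, hk⟩ : ∃ k, threshold L (K + 1) M + (K + 1) = k + 1 := ⟨_, rfl⟩
    obtain ⟨j, hj, w', hw'⟩ := hshort k (by rw [horizon]; omega)
    refine ⟨j, hj, w', ?_⟩
    rw [← hw', ← hk, prefixTotal,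
      ← disc_eq_of_zero fun i hi => costAt_stopStep_eq_zero hnoneAt hi a,
      ← disc_eq_of_zero fun i hi => costAt_stopStep_eq_zero hnoneAt hi b]
    exact hle.trans hlt

theorem IsBounded.forall_prefixTotal_pos_iff [Fintype S] [Finite Sig]
    (h : IsBounded a b α β L K M) (s : S) :
    (∀ n w, 0 < prefixTotal step a b α β s w (n + 1)) ↔
      ∀ n < horizon L (K + 1) M, ∀ w, 0 < prefixTotal step a b α β s w (n + 1) := by
  refine ⟨fun H n _ => H n, fun H n w => ?_⟩
  by_contra! hle
  obtain ⟨j, hj, w', hw'⟩ := (h.exists_short s w n).2 hle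
  exact absurd (H j hj w') hw'.not_gt

theorem IsBounded.forall_prefixTotal_nonneg_iff [Fintype S] [Finite Sig]
    (h : IsBounded a b α β L K M) (s : S) :
    (∀ n w, 0 ≤ prefixTotal step a b α β s w (n + 1)) ↔
      ∀ n < horizon L (K + 1) M, ∀ w, 0 ≤ prefixTotal step a b α β s w (n + 1) := by
  refine ⟨fun H n _ => H n, fun H n w => ?_⟩
  by_contra! hlt
  obtain ⟨j, hj, w', hw'⟩ := (h.exists_short s w n).1 hlt
  exact absurd (H j hj w') hw'.not_ge

end Halt

end DiscountedSystem

/-! ### Determinization for integer discount factors. -/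

namespace NDA

open DiscountedSystem

variable {lam : ℚ} {α Q : Type}

/-- The configurations of the determinization: the scaled gaps between the costs of reaching the
states and the least such cost, truncated at `T`. -/
abbrev Config (Q : Type) (T : ℕ) : Type := {t : Q → Fin (T + 1) // ∃ q, t q = 0}

/-- `p` is a sequence of states whose first `n` transitions on `w` form a run. -/
def IsRunUpTo (A : NDA lam α Q) (w : ℕ → α) (p : ℕ → Q) (n : ℕ) : Prop :=
  p 0 ∈ A.init ∧ ∀ i < n, (p i, w i, p (i + 1)) ∈ A.trans

theorem card_config_le [Fintype Q] (T : ℕ) [Fintype (Config Q T)] :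
    Fintype.card (Config Q T) ≤ (T + 1) ^ Fintype.card Q := by
  classical
  have h := Fintype.card_le_of_injective (Subtype.val : Config Q T → Q → Fin (T + 1))
    Subtype.val_injective
  simpa using h

/-- The cost `c` is the increase of the least cost; the new gaps are the least excesses over it,
multiplied by `r` and cut off at `T`. Values below `T` are exact; `T` stands for a gap of at least
`T` or for an unreached state. -/
theorem Complete.exists_config_step [Finite α] [Finite Q] {A : NDA lam α Q} (hA : A.Complete)
    {r T M : ℕ} {γ : Q × α × Q → ℤ} (hγ : ∀ t, |γ t| ≤ M) (t : Config Q T) (x : α) :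
    ∃ (c : ℤ) (t' : Config Q T), |c| ≤ M ∧
      (∀ q q', (q, x, q') ∈ A.trans → ((t'.1 q' : ℕ) : ℤ) ≤ r * ((t.1 q : ℕ) + γ (q, x, q') - c)) ∧
      ∀ q', (t'.1 q' : ℕ) < T → ∃ q, (q, x, q') ∈ A.trans ∧
        ((t'.1 q' : ℕ) : ℤ) = r * ((t.1 q : ℕ) + γ (q, x, q') - c) := by
  obtain ⟨q₀, hq₀⟩ := t.2
  obtain ⟨q₁, hq₁⟩ := hA.2 q₀ x
  obtain ⟨⟨a, b⟩, hab, hmin⟩ := Set.exists_min_image {e : Q × Q | (e.1, x, e.2) ∈ A.trans}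
    (fun e => ((t.1 e.1 : ℕ) : ℤ) + γ (e.1, x, e.2)) (Set.toFinite _) ⟨(q₀, q₁), hq₁⟩
  set c : ℤ := ((t.1 a : ℕ) : ℤ) + γ (a, x, b) with hc
  have hcle : ∀ q q', (q, x, q') ∈ A.trans → c ≤ (t.1 q : ℕ) + γ (q, x, q') :=
    fun q q' h => hmin (q, q') h
  have hnext : ∀ q', ∃ y : Fin (T + 1),
      (∀ q, (q, x, q') ∈ A.trans → ((y : ℕ) : ℤ) ≤ r * ((t.1 q : ℕ) + γ (q, x, q') - c)) ∧
      ((y : ℕ) < T → ∃ q, (q, x, q') ∈ A.trans ∧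
        ((y : ℕ) : ℤ) = r * ((t.1 q : ℕ) + γ (q, x, q') - c)) := by
    intro q'
    by_cases hpred : ∃ q, (q, x, q') ∈ A.trans
    · obtain ⟨q, hq, hqmin⟩ := Set.exists_min_image {q : Q | (q, x, q') ∈ A.trans}
        (fun q => (r : ℤ) * ((t.1 q : ℕ) + γ (q, x, q') - c)) (Set.toFinite _) hpred
      obtain ⟨y, hy⟩ : ∃ y : ℕ, (y : ℤ) = r * ((t.1 q : ℕ) + γ (q, x, q') - c) :=
        ⟨_, Int.toNat_of_nonneg (mul_nonneg (Int.natCast_nonneg r) (sub_nonneg.2 (hcle q q' hq)))⟩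
      refine ⟨⟨min y T, by omega⟩, fun q'' hq'' => ?_, fun hlt => ⟨q, hq, ?_⟩⟩
      · have h1 := hqmin q'' hq''
        dsimp only at h1 ⊢
        rw [← hy] at h1
        refine le_trans ?_ h1
        exact_mod_cast min_le_left y T
      · rw [← hy]
        dsimp only at hlt ⊢
        have : y < T := by omega
        rw [min_eq_left this.le]
    · exact ⟨Fin.last T, fun q hq => absurd ⟨q, hq⟩ hpred, fun h => absurd h (by simp)⟩
  choose t' ht'₁ ht'₂ using hnext
  refine ⟨c, ⟨t', b, ?_⟩, ?_, fun q q' h => ht'₁ q' q h, fun q' h => ht'₂ q' h⟩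
  · have h := ht'₁ b a hab
    rw [hc, sub_self, mul_zero] at h
    exact Fin.ext (by simpa using h)
  -- The bound above comes from a transition out of a state with gap zero, the bound below from gaps
  -- being nonnegative.
  · have h1 := hcle q₀ q₁ hq₁
    have h2 := abs_le.1 (hγ (q₀, x, q₁))
    have h3 := abs_le.1 (hγ (a, x, b))
    rw [hq₀] at h1
    simp only [Fin.val_zero, Nat.cast_zero, zero_add] at h1
    rw [abs_le]
    omega

theorem Complete.exists_extend {A : NDA lam α Q} (hA : A.Complete) {w : ℕ → α} {p : ℕ → Q} {n : ℕ}
    (hp : A.IsRunUpTo w p n) : ∃ p', A.IsInfRun w p' ∧ ∀ i ≤ n, p' i = p i := by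
  choose f hf using hA.2
  let g : ℕ → Q := fun k => Nat.rec (p n) (fun j q => f q (w (n + j))) k
  refine ⟨fun i => if i ≤ n then p i else g (i - n), ⟨by simpa using hp.1, fun i => ?_⟩,
    fun i hi => if_pos hi⟩
  rcases lt_trichotomy i n with h | rfl | h
  · simp only [h.le, Nat.succ_le_of_lt h, if_true]
    exact hp.2 i h
  · simpa [g] using hf (p i) (w i)
  · obtain ⟨k, rfl⟩ := Nat.exists_eq_add_of_lt h
    simp only [show ¬ n + k + 1 ≤ n by omega, show ¬ n + k + 1 + 1 ≤ n by omega, if_false]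
    rw [show n + k + 1 - n = k + 1 by omega, show n + k + 1 + 1 - n = k + 1 + 1 by omega]
    exact hf (g (k + 1)) (w (n + k + 1))

/-- The costs along a run. -/
def runCost (γ : Q × α × Q → ℤ) (w : ℕ → α) (p : ℕ → Q) (i : ℕ) : ℤ := γ (p i, w i, p (i + 1))

/-- A deterministic system computes the least scaled value of the runs of `A` on finite words. -/
structure IsDeterminization {S : Type} (A : NDA lam α Q) (r : ℕ) (γ : Q × α × Q → ℤ)
    (step : S → α → S) (c : S → α → ℤ) (s : S) : Prop where
  le : ∀ w p n, A.IsRunUpTo w p n →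
    discPrefix r (costAt step c s w) n ≤ discPrefix r (runCost γ w p) n
  exists_eq : ∀ w n, ∃ p, A.IsInfRun w p ∧
    discPrefix r (runCost γ w p) n = discPrefix r (costAt step c s w) n

theorem pow_mul_discPrefix_succ {r : ℕ} (hr : 2 ≤ r) (c : ℕ → ℤ) (n : ℕ) :
    (r : ℝ) ^ (n + 1) * discPrefix r c (n + 1) = r * ((r : ℝ) ^ n * discPrefix r c n + c n) := by
  have hr' : (r : ℝ) ≠ 0 := by exact_mod_cast (show r ≠ 0 by omega)
  rw [discPrefix, Finset.sum_range_succ, ← discPrefix, pow_succ]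
  field_simp

theorem Complete.exists_determinization [Finite α] [Finite Q] {A : NDA lam α Q} (hA : A.Complete)
    {r T M : ℕ} (hr : 2 ≤ r) {γ : Q × α × Q → ℤ} (hγ : ∀ t, |γ t| ≤ M) (hT : 0 < T)
    (hTM : 4 * M ≤ T) :
    ∃ (step : Config Q T → α → Config Q T) (c : Config Q T → α → ℤ) (s : Config Q T),
      (∀ s x, |c s x| ≤ M) ∧ A.IsDeterminization r γ step c s := by
  classical
  have hstep := fun (t : Config Q T) x => hA.exists_config_step (r := r) hγ t x
  choose c step hc hle hex using hstep
  obtain ⟨q₀, hq₀⟩ := hA.1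
  refine ⟨step, c, ⟨fun q => if q ∈ A.init then 0 else Fin.last T, q₀, if_pos hq₀⟩, hc, ?_, ?_⟩
  all_goals set s : Config Q T := ⟨fun q => if q ∈ A.init then 0 else Fin.last T, q₀, if_pos hq₀⟩
  · intro w p n hp
    -- The stored gap never exceeds the true scaled gap of a run; as it is nonnegative, no run is
    -- cheaper than the system.
    have key : ∀ k ≤ n, (((stateAt step s w k).1 (p k) : ℕ) : ℝ) ≤
        (r : ℝ) ^ k * discPrefix r (runCost γ w p) k -
          (r : ℝ) ^ k * discPrefix r (costAt step c s w) k := by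
      intro k hk
      induction k with
      | zero =>
        have h0 : (stateAt step s w 0).1 (p 0) = 0 := if_pos hp.1
        simp [h0, discPrefix]
      | succ k ih =>
        have h1 := hle (stateAt step s w k) (w k) (p k) (p (k + 1)) (hp.2 k (by omega))
        have h2 : (((stateAt step s w (k + 1)).1 (p (k + 1)) : ℕ) : ℝ) ≤
            r * (((stateAt step s w k).1 (p k) : ℕ) + runCost γ w p k - costAt step c s w k) := by
          exact_mod_cast h1
        rw [pow_mul_discPrefix_succ hr, pow_mul_discPrefix_succ hr, ← mul_sub]
        refine h2.trans (mul_le_mul_of_nonneg_left ?_ (by positivity))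
        linarith [ih (by omega)]
    have h := (Nat.cast_nonneg _).trans (key n le_rfl)
    have hr' : (0 : ℝ) < (r : ℝ) ^ n := by
      have : (0 : ℝ) < r := by exact_mod_cast (show 0 < r by omega)
      positivity
    rw [← mul_sub] at h
    linarith [nonneg_of_mul_nonneg_right h hr']
  · intro w n
    -- Gaps below `T` are realized by runs; the state with gap zero then yields an optimal run.
    have key : ∀ k q, ((stateAt step s w k).1 q : ℕ) < T → ∃ p, A.IsRunUpTo w p k ∧ p k = q ∧
        (((stateAt step s w k).1 q : ℕ) : ℝ) =
        (r : ℝ) ^ k * discPrefix r (runCost γ w p) k -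
          (r : ℝ) ^ k * discPrefix r (costAt step c s w) k := by
      intro k
      induction k with
      | zero =>
        intro q hq
        have hqi : q ∈ A.init := by
          by_contra hqi
          have h0 : (stateAt step s w 0).1 q = Fin.last T := if_neg hqi
          rw [h0] at hq
          simp at hq
        have h0 : (stateAt step s w 0).1 q = 0 := if_pos hqi
        exact ⟨fun _ => q, ⟨hqi, fun i hi => absurd hi (Nat.not_lt_zero i)⟩, rfl,
          by simp [h0, discPrefix]⟩
      | succ k ih =>
        intro q' hq'
        obtain ⟨q, htr, heq⟩ := hex (stateAt step s w k) (w k) q' hq'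
        change (((stateAt step s w (k + 1)).1 q' : ℕ) : ℤ) = _ at heq
        -- A truncated gap does not recover: `r * (T + γ - c) ≥ 2 * (T - 2 * M) ≥ T`, as `4 * M ≤
        -- T`.
        have hlt : ((stateAt step s w k).1 q : ℕ) < T := by
          have h1 := abs_le.1 (hγ (q, w k, q'))
          have h2 := abs_le.1 (hc (stateAt step s w k) (w k))
          by_contra! hge
          have hr' : (2 : ℤ) ≤ r := by exact_mod_cast hr
          zify at hge hq' hTM
          nlinarith
        obtain ⟨p, hp, hpk, hval⟩ := ih q hlt
        have hagree : ∀ i ≤ k, Function.update p (k + 1) q' i = p i :=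
          fun i hi => Function.update_of_ne (by omega) _ _
        have hlast : Function.update p (k + 1) q' (k + 1) = q' := Function.update_self ..
        refine ⟨Function.update p (k + 1) q', ⟨?_, fun i hi => ?_⟩, hlast, ?_⟩
        · rw [hagree 0 (Nat.zero_le _)]
          exact hp.1
        · rcases (Nat.lt_succ_iff.1 hi).eq_or_lt with rfl | hi
          · rw [hlast, hagree i le_rfl, hpk]
            exact htr
          · rw [hagree i hi.le, hagree (i + 1) hi]
            exact hp.2 i hi
        · have heq' : (((stateAt step s w (k + 1)).1 q' : ℕ) : ℝ) =
              r * (((stateAt step s w k).1 q : ℕ) + γ (q, w k, q') - costAt step c s w k) := by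
            exact_mod_cast heq
          have hpre : discPrefix r (runCost γ w (Function.update p (k + 1) q')) k =
              discPrefix r (runCost γ w p) k := discPrefix_congr fun i hi => by
            rw [runCost, runCost, hagree i hi.le, hagree (i + 1) hi]
          have hk : runCost γ w (Function.update p (k + 1) q') k = γ (q, w k, q') := by
            rw [runCost, hlast, hagree k le_rfl, hpk]
          rw [heq', pow_mul_discPrefix_succ hr, pow_mul_discPrefix_succ hr, hpre, hk, hval]
          ring
    obtain ⟨q, hq⟩ := (stateAt step s w n).2
    obtain ⟨p, hp, -, hval⟩ := key n q (by rw [hq]; exact hT)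
    obtain ⟨p', hp', hagree⟩ := hA.exists_extend hp
    refine ⟨p', hp', ?_⟩
    have hpre : discPrefix r (runCost γ w p') n = discPrefix r (runCost γ w p) n :=
      discPrefix_congr fun i hi => by
        rw [runCost, runCost, hagree i hi.le, hagree (i + 1) hi]
    rw [hpre]
    have hr' : (r : ℝ) ^ n ≠ 0 := pow_ne_zero _ (by exact_mod_cast (show r ≠ 0 by omega))
    rw [hq, ← mul_sub] at hval
    simp only [Fin.val_zero, Nat.cast_zero] at hval
    rcases mul_eq_zero.1 hval.symm with h | h
    · exact absurd h hr'
    · linarith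

/-! ### Values of words from the determinization. -/

section Values

variable {S : Type} {r D M : ℕ} {γ : Q × α × Q → ℤ} {step : S → α → S}
  {c : S → α → ℤ} {s : S}

theorem IsInfRun.isRunUpTo {A : NDA lam α Q} {w : ℕ → α} {p : ℕ → Q} (h : A.IsInfRun w p) (n : ℕ) :
    A.IsRunUpTo w p n := ⟨h.1, fun i _ => h.2 i⟩

theorem discPrefix_runCost {A : NDA (r : ℚ) α Q} (hγ : ∀ t, (γ t : ℝ) = D * (A.weight t : ℝ))
    (w : ℕ → α) (p : ℕ → Q) (n : ℕ) :
    discPrefix r (runCost γ w p) n =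
      D * A.finRunValue (fun i : Fin n => w i) (fun i : Fin (n + 1) => p i) := by
  rw [discPrefix, ← Fin.sum_univ_eq_sum_range
    (fun i => (runCost γ w p i : ℝ) / (r : ℝ) ^ i), finRunValue, Finset.mul_sum]
  refine Finset.sum_congr rfl fun i _ => ?_
  rw [runCost, hγ]
  simp [mul_div_assoc]

theorem disc_runCost {A : NDA (r : ℚ) α Q} (hγ : ∀ t, (γ t : ℝ) = D * (A.weight t : ℝ))
    (w : ℕ → α) (p : ℕ → Q) : disc r (runCost γ w p) = D * A.infRunValue w p := by
  rw [disc, infRunValue, ← tsum_mul_left]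
  refine tsum_congr fun i => ?_
  rw [runCost, hγ]
  simp [mul_div_assoc]

/-- The value of a finite word in terms of a determinization. -/
theorem IsDeterminization.finValue_eq {A : NDA (r : ℚ) α Q}
    (h : A.IsDeterminization r γ step c s) (hD : 0 < D)
    (hγ : ∀ t, (γ t : ℝ) = D * (A.weight t : ℝ)) (w : ℕ → α) (n : ℕ) :
    A.finValue (fun i : Fin n => w i) =
      ((discPrefix r (costAt step c s w) n / D : ℝ) : EReal) := by
  have hD' : (0 : ℝ) < D := by exact_mod_cast hD
  refine le_antisymm (sInf_le ?_) (le_sInf ?_)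
  · obtain ⟨p, hp, heq⟩ := h.exists_eq w n
    refine ⟨fun i => p i, ⟨hp.1, fun i => by simpa using hp.2 i⟩, ?_⟩
    rw [← heq, discPrefix_runCost hγ, mul_div_cancel_left₀ _ hD'.ne']
  · rintro _ ⟨p, hp, rfl⟩
    set p' : ℕ → Q := fun i => if hi : i < n + 1 then p ⟨i, hi⟩ else p 0 with hp'
    have hpp' : (fun i : Fin (n + 1) => p' i) = p := by
      funext i
      exact dif_pos i.isLt
    have hrun : A.IsRunUpTo w p' n := by
      refine ⟨by simpa [hp'] using hp.1, fun i hi => ?_⟩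
      have := hp.2 ⟨i, hi⟩
      simp only [hp', show i < n + 1 by omega, show i + 1 < n + 1 by omega, dif_pos]
      exact this
    have hle := h.le w p' n hrun
    rw [discPrefix_runCost hγ, hpp'] at hle
    rw [EReal.coe_le_coe_iff, div_le_iff₀ hD']
    linarith

/-- The value of an infinite word in terms of a determinization. -/
theorem IsDeterminization.infValue_eq {A : NDA (r : ℚ) α Q}
    (h : A.IsDeterminization r γ step c s) (hr : 2 ≤ r) (hD : 0 < D)
    (hγ : ∀ t, (γ t : ℝ) = D * (A.weight t : ℝ)) (hM : ∀ t, |γ t| ≤ M) (hc : ∀ s x, |c s x| ≤ M)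
    (w : ℕ → α) :
    A.infValue w = ((disc r (costAt step c s w) / D : ℝ) : EReal) := by
  have hD' : (0 : ℝ) < D := by exact_mod_cast hD
  have hlim := tendsto_discPrefix hr (c := costAt step c s w) fun i => hc _ _
  have hlimp : ∀ p : ℕ → Q, Filter.Tendsto (discPrefix r (runCost γ w p)) Filter.atTop
      (nhds (disc r (runCost γ w p))) := fun p => tendsto_discPrefix hr fun i => hM _
  refine le_antisymm ?_ (le_sInf ?_)
  -- Runs `p n` that are optimal on the first `n` letters suffice: their values lie within `2 * M /
  -- r ^ n` of the optimal prefix, so no run attaining the infimum has to be constructed.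
  · choose p hp heq using h.exists_eq w
    have hub : ∀ n, A.infValue w ≤
        (((discPrefix r (costAt step c s w) n + 2 * M / (r : ℝ) ^ n) / D : ℝ) : EReal) := by
      intro n
      have hmem : A.infValue w ≤ (A.infRunValue w (p n) : EReal) := sInf_le ⟨p n, hp n, rfl⟩
      refine hmem.trans ?_
      rw [EReal.coe_le_coe_iff, le_div_iff₀ hD', mul_comm, ← disc_runCost hγ, ← heq n]
      have := (abs_le.1 (abs_disc_sub_discPrefix_le hr (M := M) (c := runCost γ w (p n))
        (fun i => hM _) n)).2
      linarith
    have ht := (hlim.add (tendsto_pow_inv hr (2 * M))).div_const (D : ℝ)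
    rw [add_zero] at ht
    exact ge_of_tendsto' ((continuous_coe_real_ereal.tendsto _).comp ht) hub
  · rintro _ ⟨p, hp, rfl⟩
    rw [EReal.coe_le_coe_iff, div_le_iff₀ hD', mul_comm, ← disc_runCost hγ]
    exact le_of_tendsto_of_tendsto' hlim (hlimp p) fun n => h.le w p n (hp.isRunUpTo n)

end Values

end NDA

/-! ### Primitive recursive arithmetic and bounded quantifiers. -/

section PrimrecLemmas

open Encodable

theorem Int.encode_eq (z : ℤ) : @encode ℤ Primcodable.toEncodable z =
    if 0 ≤ z then 2 * z.toNat else 2 * (-z).toNat - 1 := by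
  rcases z with n | n
  · change 2 * n = _
    simp
  · change 2 * n + 1 = _
    have : ¬ (0 ≤ Int.negSucc n) := by omega
    rw [if_neg this]
    omega

/-- Serves, with `encode_le_of_mem`, to bound all data of an input by its code, so that every search
bound is a function of one number. -/
theorem Int.natAbs_le_encode (z : ℤ) : z.natAbs ≤ @encode ℤ Primcodable.toEncodable z := by
  rw [Int.encode_eq]
  split_ifs <;> omega

theorem Primrec.int_toNat : Primrec Int.toNat := by
  have h : PrimrecPred fun z : ℤ => encode z % 2 = 0 :=
    Primrec.eq.comp (Primrec.nat_mod.comp Primrec.encode (Primrec.const 2)) (Primrec.const 0)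
  refine (Primrec.ite h (Primrec.nat_div.comp Primrec.encode (Primrec.const 2))
    (Primrec.const 0)).of_eq fun z => ?_
  rw [Int.encode_eq]
  split_ifs <;> omega

theorem Primrec.int_neg_toNat : Primrec fun z : ℤ => (-z).toNat := by
  have h : PrimrecPred fun z : ℤ => encode z % 2 = 0 :=
    Primrec.eq.comp (Primrec.nat_mod.comp Primrec.encode (Primrec.const 2)) (Primrec.const 0)
  refine (Primrec.ite h (Primrec.const 0) (Primrec.nat_div.comp
    (Primrec.succ.comp Primrec.encode) (Primrec.const 2))).of_eq fun z => ?_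
  rw [Int.encode_eq]
  split_ifs <;> omega

theorem Primrec.nat_pow : Primrec₂ ((· ^ ·) : ℕ → ℕ → ℕ) :=
  Primrec₂.unpaired'.1 Nat.Primrec.pow

theorem Primrec.nat_factorial : Primrec Nat.factorial := by
  refine (Primrec.nat_rec₁ (f := fun n k => (n + 1) * k) 1
    (Primrec.nat_mul.comp (Primrec.succ.comp Primrec.fst) Primrec.snd)).of_eq fun n => ?_
  induction n with
  | zero => rfl
  | succ n ih => rw [Nat.factorial_succ, ← ih]

variable {β : Type} [Primcodable β]

theorem Primrec.sum_range {f : β → ℕ} {g : β → ℕ → ℕ} (hf : Primrec f) (hg : Primrec₂ g) :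
    Primrec fun b => ∑ i ∈ Finset.range (f b), g b i := by
  refine (Primrec.nat_rec' (h := fun b (q : ℕ × ℕ) => q.2 + g b q.1) hf (Primrec.const 0)
    (Primrec.nat_add.comp (Primrec.snd.comp Primrec.snd)
      (hg.comp Primrec.fst (Primrec.fst.comp Primrec.snd)))).of_eq fun b => ?_
  induction f b with
  | zero => rfl
  | succ n ih => rw [Finset.sum_range_succ, ← ih]

theorem PrimrecPred.forall_lt_comp {f : β → ℕ} {P : β → ℕ → Prop} (hf : Primrec f)
    (hP : PrimrecPred fun y : β × ℕ => P y.1 y.2) : PrimrecPred fun b => ∀ i < f b, P b i := by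
  have hR : PrimrecRel fun (i : ℕ) (b : β) => P b i :=
    hP.comp (Primrec.pair Primrec.snd Primrec.fst)
  exact (hR.forall_mem_list.comp (Primrec.list_range.comp hf) Primrec.id).of_eq (by simp)

theorem PrimrecPred.exists_lt_comp {f : β → ℕ} {P : β → ℕ → Prop} (hf : Primrec f)
    (hP : PrimrecPred fun y : β × ℕ => P y.1 y.2) : PrimrecPred fun b => ∃ i < f b, P b i := by
  have hR : PrimrecRel fun (i : ℕ) (b : β) => P b i :=
    hP.comp (Primrec.pair Primrec.snd Primrec.fst)
  exact (hR.exists_mem_list.comp (Primrec.list_range.comp hf) Primrec.id).of_eq (by simp)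

theorem Encodable.encode_le_of_mem {α : Type} [Encodable α] {a : α} {l : List α} (h : a ∈ l) :
    encode a ≤ encode l := by
  induction l with
  | nil => simp at h
  | cons b l ih =>
    rw [encode_list_cons]
    rcases List.mem_cons.1 h with rfl | h
    · exact (Nat.left_le_pair _ _).trans (Nat.le_succ _)
    · exact (ih h).trans ((Nat.right_le_pair _ _).trans (Nat.le_succ _))

end PrimrecLemmas

/-- The sequence of the digits of `k` in base `b`. -/
def digitSeq (b k i : ℕ) : ℕ := k / b ^ i % b

theorem digitSeq_lt {b : ℕ} (hb : 0 < b) (k i : ℕ) : digitSeq b k i < b := Nat.mod_lt _ hb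

/-- Turns quantifiers over words and runs of length `n` into bounded quantifiers over numbers. -/
theorem exists_digitSeq_eq {b : ℕ} (n : ℕ) (f : ℕ → ℕ) (hf : ∀ i < n, f i < b) :
    ∃ k < b ^ n, ∀ i < n, digitSeq b k i = f i := by
  induction n generalizing f with
  | zero => exact ⟨0, by simp, fun i hi => absurd hi (Nat.not_lt_zero i)⟩
  | succ n ih =>
    obtain ⟨k, hk, hdig⟩ := ih (fun i => f (i + 1)) fun i hi => hf (i + 1) (by omega)
    have h0 := hf 0 (by omega)
    refine ⟨f 0 + b * k, ?_, fun i hi => ?_⟩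
    · calc f 0 + b * k < b * (k + 1) := by rw [mul_add, mul_one]; omega
        _ ≤ b * b ^ n := Nat.mul_le_mul_left _ hk
        _ = b ^ (n + 1) := by rw [pow_succ, mul_comm]
    · rcases i with _ | i
      · simp [digitSeq, Nat.mod_eq_of_lt h0]
      · rw [← hdig i (by omega), digitSeq, digitSeq, pow_succ', ← Nat.div_div_eq_div_mul,
          Nat.add_mul_div_left _ _ (by omega), Nat.div_eq_of_lt h0, zero_add]

theorem Primrec.digitSeq {β : Type} [Primcodable β] {b k i : β → ℕ} (hb : Primrec b)
    (hk : Primrec k) (hi : Primrec i) : Primrec fun y => digitSeq (b y) (k y) (i y) :=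
  Primrec.nat_mod.comp (Primrec.nat_div.comp hk (Primrec.nat_pow.comp hb hi)) hb

/-! ### Runs and their costs computed from the code of an automaton. -/

namespace NDACode

open Encodable

theorem primrec_equivProd : Primrec NDACode.equivProd := Primrec.of_equiv

theorem primrec_discount : Primrec NDACode.discount :=
  (Primrec.fst.comp primrec_equivProd).of_eq fun _ => rfl

theorem primrec_numStates : Primrec NDACode.numStates :=
  (Primrec.fst.comp (Primrec.snd.comp primrec_equivProd)).of_eq fun _ => rfl

theorem primrec_init : Primrec NDACode.init :=
  (Primrec.fst.comp (Primrec.snd.comp (Primrec.snd.comp primrec_equivProd))).of_eq fun _ => rfl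

theorem primrec_table : Primrec NDACode.table :=
  (Primrec.snd.comp (Primrec.snd.comp (Primrec.snd.comp primrec_equivProd))).of_eq fun _ => rfl

theorem encode_eq (c : NDACode) : encode c =
    Nat.pair c.discount (Nat.pair c.numStates (Nat.pair (encode c.init) (encode c.table))) := by
  change encode (NDACode.equivProd c) = _
  rw [NDACode.equivProd, Equiv.coe_fn_mk, encode_prod_val, encode_prod_val, encode_prod_val,
    encode_nat, encode_nat]

theorem discount_le_encode (c : NDACode) : c.discount ≤ encode c := by
  rw [encode_eq]
  exact Nat.left_le_pair _ _

theorem numStates_le_encode (c : NDACode) : c.numStates ≤ encode c := by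
  rw [encode_eq]
  exact (Nat.left_le_pair _ _).trans (Nat.right_le_pair _ _)

theorem le_encode_of_lookup (c : NDACode) {k : ℕ × ℕ × ℕ} {z : ℤ} {y : ℕ}
    (h : c.table.lookup k = some (z, y)) : z.natAbs ≤ encode c ∧ y ≤ encode c := by
  obtain ⟨l₁, l₂, hl, -⟩ := List.lookup_eq_some_iff.1 h
  have hmem : (k, (z, y)) ∈ c.table := hl ▸ by simp
  have h1 := encode_le_of_mem hmem
  have h2 : encode c.table ≤ encode c := by
    rw [encode_eq]
    exact (Nat.right_le_pair _ _).trans ((Nat.right_le_pair _ _).trans (Nat.right_le_pair _ _))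
  have h3 : encode (z, y) ≤ encode (k, (z, y)) := by
    rw [encode_prod_val]
    exact Nat.right_le_pair _ _
  have h4 : z.natAbs ≤ encode (z, y) := by
    rw [encode_prod_val]
    exact (Int.natAbs_le_encode z).trans (Nat.left_le_pair _ _)
  have h5 : y ≤ encode (z, y) := by
    rw [encode_prod_val]
    exact Nat.right_le_pair _ _
  omega

/-- The sequence `p` of states describes a run on the first `n` letters of `w`. -/
def IsRunSeq (c : NDACode) (w p : ℕ → ℕ) (n : ℕ) : Prop :=
  p 0 ∈ c.init ∧ ∀ i < n, (c.table.lookup (p i, w i, p (i + 1))).isSome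

/-- The positive part of a weight, multiplied by `D`. -/
def posPart (D : ℕ) (o : Option (ℤ × ℕ)) : ℕ :=
  (o.map fun x => x.1.toNat * (D / (x.2 + 1))).getD 0

/-- The negative part of a weight, multiplied by `D`. -/
def negPart (D : ℕ) (o : Option (ℤ × ℕ)) : ℕ :=
  (o.map fun x => (-x.1).toNat * (D / (x.2 + 1))).getD 0

/-- The discounted sum of the parts `f D` of the weights, multiplied by powers of the two discount
factors so that it is a natural number. -/
def gain (f : ℕ → Option (ℤ × ℕ) → ℕ) (c : NDACode) (D r : ℕ) (w p : ℕ → ℕ) (n : ℕ) : ℕ :=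
  ∑ i ∈ Finset.range n,
    f D (c.table.lookup (p i, w i, p (i + 1))) * c.discount ^ (n - i) * r ^ n

theorem isRunSeq_congr {c : NDACode} {w w' p p' : ℕ → ℕ} {n : ℕ} (hw : ∀ i < n, w i = w' i)
    (hp : ∀ i < n + 1, p i = p' i) : c.IsRunSeq w p n ↔ c.IsRunSeq w' p' n := by
  rw [IsRunSeq, IsRunSeq, hp 0 (by omega)]
  refine and_congr_right fun _ => forall₂_congr fun i hi => ?_
  rw [hw i hi, hp i (by omega), hp (i + 1) (by omega)]

theorem gain_congr (f : ℕ → Option (ℤ × ℕ) → ℕ) (c : NDACode) (D r : ℕ) {w w' p p' : ℕ → ℕ} {n : ℕ}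
    (hw : ∀ i < n, w i = w' i) (hp : ∀ i < n + 1, p i = p' i) :
    gain f c D r w p n = gain f c D r w' p' n := by
  refine Finset.sum_congr rfl fun i hi => ?_
  have hi := Finset.mem_range.1 hi
  rw [hw i hi, hp i (by omega), hp (i + 1) (by omega)]

section Primrec

variable {β : Type} [Primcodable β]

theorem primrec_posPart : Primrec₂ posPart := by
  have h : Primrec₂ fun (y : ℕ × Option (ℤ × ℕ)) (x : ℤ × ℕ) => x.1.toNat * (y.1 / (x.2 + 1)) :=
    Primrec.nat_mul.comp (Primrec.int_toNat.comp (Primrec.fst.comp Primrec.snd))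
      (Primrec.nat_div.comp (Primrec.fst.comp Primrec.fst)
        (Primrec.succ.comp (Primrec.snd.comp Primrec.snd)))
  exact Primrec.option_getD.comp (Primrec.option_map Primrec.snd h) (Primrec.const 0)

theorem primrec_negPart : Primrec₂ negPart := by
  have h : Primrec₂ fun (y : ℕ × Option (ℤ × ℕ)) (x : ℤ × ℕ) =>
      (-x.1).toNat * (y.1 / (x.2 + 1)) :=
    Primrec.nat_mul.comp (Primrec.int_neg_toNat.comp (Primrec.fst.comp Primrec.snd))
      (Primrec.nat_div.comp (Primrec.fst.comp Primrec.fst)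
        (Primrec.succ.comp (Primrec.snd.comp Primrec.snd)))
  exact Primrec.option_getD.comp (Primrec.option_map Primrec.snd h) (Primrec.const 0)

theorem primrec_lookup {c : β → NDACode} {q x q' : β → ℕ} (hc : Primrec c) (hq : Primrec q)
    (hx : Primrec x) (hq' : Primrec q') :
    Primrec fun b => (c b).table.lookup (q b, x b, q' b) := by
  -- The two Boolean equality tests on triples agree, both being lawful.
  have h : (instBEqOfDecidableEq : BEq (ℕ × ℕ × ℕ)) = instBEqProd := lawful_beq_subsingleton _ _
  exact (Primrec.listLookup.comp (hq.pair (hx.pair hq')) (primrec_table.comp hc)).of_eq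
    fun b => by rw [h]

theorem primrecPred_mem_init {c : β → NDACode} {q : β → ℕ} (hc : Primrec c) (hq : Primrec q) :
    PrimrecPred fun b => q b ∈ (c b).init := by
  have h := (Primrec.eq (α := ℕ)).exists_mem_list.comp (primrec_init.comp hc) hq
  exact h.of_eq (by simp)

theorem primrecPred_isSome {o : β → Option (ℤ × ℕ)} (ho : Primrec o) :
    PrimrecPred fun b => (o b).isSome :=
  Primrec.eq.comp (Primrec.option_isSome.comp ho) (Primrec.const true)

theorem primrec_lookup_digitSeq {c : β → NDACode} {m k q : β → ℕ} (hc : Primrec c)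
    (hm : Primrec m) (hk : Primrec k) (hq : Primrec q) :
    Primrec fun y : β × ℕ => (c y.1).table.lookup (digitSeq (c y.1).numStates (q y.1) y.2,
      digitSeq (m y.1) (k y.1) y.2, digitSeq (c y.1).numStates (q y.1) (y.2 + 1)) := by
  have hc' := hc.comp (Primrec.fst (α := β) (β := ℕ))
  have hs := primrec_numStates.comp hc'
  have hq' := hq.comp (Primrec.fst (α := β) (β := ℕ))
  exact primrec_lookup hc' (Primrec.digitSeq hs hq' Primrec.snd)
    (Primrec.digitSeq (hm.comp Primrec.fst) (hk.comp Primrec.fst) Primrec.snd)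
    (Primrec.digitSeq hs hq' (Primrec.succ.comp Primrec.snd))

theorem primrecPred_isRunSeq {c : β → NDACode} {m k q n : β → ℕ} (hc : Primrec c)
    (hm : Primrec m) (hk : Primrec k) (hq : Primrec q) (hn : Primrec n) :
    PrimrecPred fun b => (c b).IsRunSeq (digitSeq (m b) (k b))
      (digitSeq (c b).numStates (q b)) (n b) :=
  (primrecPred_mem_init hc (Primrec.digitSeq (primrec_numStates.comp hc) hq (Primrec.const 0))).and
    (PrimrecPred.forall_lt_comp hn (primrecPred_isSome (primrec_lookup_digitSeq hc hm hk hq)))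

theorem primrec_gain {f : ℕ → Option (ℤ × ℕ) → ℕ} (hf : Primrec₂ f) {c : β → NDACode}
    {D r m k q n : β → ℕ} (hc : Primrec c) (hD : Primrec D) (hr : Primrec r) (hm : Primrec m)
    (hk : Primrec k) (hq : Primrec q) (hn : Primrec n) :
    Primrec fun b => gain f (c b) (D b) (r b) (digitSeq (m b) (k b))
      (digitSeq (c b).numStates (q b)) (n b) := by
  refine Primrec.sum_range hn ?_
  exact Primrec.nat_mul.comp (Primrec.nat_mul.comp
    (hf.comp (hD.comp Primrec.fst) (primrec_lookup_digitSeq hc hm hk hq))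
    (Primrec.nat_pow.comp (primrec_discount.comp (hc.comp Primrec.fst))
      (Primrec.nat_sub.comp (hn.comp Primrec.fst) Primrec.snd)))
    (Primrec.nat_pow.comp (hr.comp Primrec.fst) (hn.comp Primrec.fst))

end Primrec

end NDACode

/-! ### The finite test and its primitive recursiveness. -/

namespace NDAPair

open Encodable NDACode

theorem primrec_equivProd : Primrec NDAPair.equivProd := Primrec.of_equiv

theorem primrec_alphabetSize : Primrec NDAPair.alphabetSize :=
  (Primrec.fst.comp primrec_equivProd).of_eq fun _ => rfl

theorem primrec_fst : Primrec NDAPair.fst :=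
  (Primrec.fst.comp (Primrec.snd.comp primrec_equivProd)).of_eq fun _ => rfl

theorem primrec_snd : Primrec NDAPair.snd :=
  (Primrec.snd.comp (Primrec.snd.comp primrec_equivProd)).of_eq fun _ => rfl

theorem encode_eq (x : NDAPair) :
    encode x = Nat.pair x.alphabetSize (Nat.pair (encode x.fst) (encode x.snd)) := by
  change encode (NDAPair.equivProd x) = _
  rw [NDAPair.equivProd, Equiv.coe_fn_mk, encode_prod_val, encode_prod_val, encode_nat]

theorem encode_fst_le (x : NDAPair) : encode x.fst ≤ encode x := by
  rw [encode_eq]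
  exact (Nat.left_le_pair _ _).trans (Nat.right_le_pair _ _)

theorem encode_snd_le (x : NDAPair) : encode x.snd ≤ encode x := by
  rw [encode_eq]
  exact (Nat.right_le_pair _ _).trans (Nat.right_le_pair _ _)

/-- The two automata in the other order. -/
def swap (x : NDAPair) : NDAPair := ⟨x.alphabetSize, x.snd, x.fst⟩

theorem primrec_swap : Primrec swap :=
  ((Primrec.of_equiv_symm (e := NDAPair.equivProd)).comp
    (primrec_alphabetSize.pair (primrec_snd.pair primrec_fst))).of_eq fun _ => rfl

/-- The run `p` of the first automaton costs more than the run `p'` of the second one, up to the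
summands `e₁` and `e₂`. -/
def CostsMore (x : NDAPair) (D e₁ e₂ : ℕ) (w p p' : ℕ → ℕ) (n : ℕ) : Prop :=
  x.snd.gain posPart D x.fst.discount w p' n + x.fst.gain negPart D x.snd.discount w p n + e₂ <
    x.fst.gain posPart D x.snd.discount w p n + x.snd.gain negPart D x.fst.discount w p' n + e₁

/-- On every word of length `n`, for every run of the first automaton there is a run of the second
one that costs less. -/
def Check (x : NDAPair) (n D e₁ e₂ : ℕ) : Prop :=
  ∀ k < x.alphabetSize ^ n, ∀ q < x.fst.numStates ^ (n + 1),
    ¬ x.fst.IsRunSeq (digitSeq x.alphabetSize k) (digitSeq x.fst.numStates q) n ∨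
    ∃ q' < x.snd.numStates ^ (n + 1),
      x.snd.IsRunSeq (digitSeq x.alphabetSize k) (digitSeq x.snd.numStates q') n ∧
      x.CostsMore D e₁ e₂ (digitSeq x.alphabetSize k) (digitSeq x.fst.numStates q)
        (digitSeq x.snd.numStates q') n

theorem primrecPred_check {β : Type} [Primcodable β] {x : β → NDAPair} {n D e₁ e₂ : β → ℕ}
    (hx : Primrec x) (hn : Primrec n) (hD : Primrec D) (h₁ : Primrec e₁) (h₂ : Primrec e₂) :
    PrimrecPred fun b => (x b).Check (n b) (D b) (e₁ b) (e₂ b) := by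
  have hm := primrec_alphabetSize.comp hx
  have hA := primrec_fst.comp hx
  have hB := primrec_snd.comp hx
  have hn1 := Primrec.succ.comp hn
  refine PrimrecPred.forall_lt_comp (Primrec.nat_pow.comp hm hn) ?_
  refine PrimrecPred.forall_lt_comp
    (Primrec.nat_pow.comp (primrec_numStates.comp (hA.comp Primrec.fst)) (hn1.comp Primrec.fst)) ?_
  have π₂ : Primrec fun y : (β × ℕ) × ℕ => y.1.1 := Primrec.fst.comp Primrec.fst
  have κ₂ : Primrec fun y : (β × ℕ) × ℕ => y.1.2 := Primrec.snd.comp Primrec.fst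
  refine PrimrecPred.or (PrimrecPred.not (primrecPred_isRunSeq (hA.comp π₂) (hm.comp π₂) κ₂
    Primrec.snd (hn.comp π₂))) ?_
  refine PrimrecPred.exists_lt_comp
    (Primrec.nat_pow.comp (primrec_numStates.comp (hB.comp π₂)) (hn1.comp π₂)) ?_
  have π : Primrec fun y : ((β × ℕ) × ℕ) × ℕ => y.1.1.1 := π₂.comp Primrec.fst
  have κ : Primrec fun y : ((β × ℕ) × ℕ) × ℕ => y.1.1.2 := κ₂.comp Primrec.fst
  have ρ : Primrec fun y : ((β × ℕ) × ℕ) × ℕ => y.1.2 := Primrec.snd.comp Primrec.fst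
  refine PrimrecPred.and (primrecPred_isRunSeq (hB.comp π) (hm.comp π) κ
    Primrec.snd (hn.comp π)) ?_
  have hA' := hA.comp π
  have hB' := hB.comp π
  have hdA := primrec_discount.comp hA'
  have hdB := primrec_discount.comp hB'
  exact Primrec.nat_lt.comp
    (Primrec.nat_add.comp (Primrec.nat_add.comp
      (primrec_gain primrec_posPart hB' (hD.comp π) hdA (hm.comp π) κ Primrec.snd (hn.comp π))
      (primrec_gain primrec_negPart hA' (hD.comp π) hdB (hm.comp π) κ ρ (hn.comp π)))
      (h₂.comp π))
    (Primrec.nat_add.comp (Primrec.nat_add.comp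
      (primrec_gain primrec_posPart hA' (hD.comp π) hdB (hm.comp π) κ ρ (hn.comp π))
      (primrec_gain primrec_negPart hB' (hD.comp π) hdA (hm.comp π) κ Primrec.snd (hn.comp π)))
      (h₁.comp π))

theorem primrecPred_complete {c : NDAPair → NDACode} (hc : Primrec c) :
    PrimrecPred fun x : NDAPair => ((c x).toNDA x.alphabetSize).Complete := by
  have hs := primrec_numStates.comp hc
  have h : PrimrecPred fun x : NDAPair => (∃ q < (c x).numStates, q ∈ (c x).init) ∧
      ∀ q < (c x).numStates, ∀ a < x.alphabetSize, ∃ q' < (c x).numStates,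
        ((c x).table.lookup (q, a, q')).isSome := by
    refine PrimrecPred.and (PrimrecPred.exists_lt_comp hs
      (primrecPred_mem_init (hc.comp Primrec.fst) Primrec.snd)) ?_
    refine PrimrecPred.forall_lt_comp hs ?_
    refine PrimrecPred.forall_lt_comp (primrec_alphabetSize.comp Primrec.fst) ?_
    have π : Primrec fun y : (NDAPair × ℕ) × ℕ => y.1.1 := Primrec.fst.comp Primrec.fst
    refine PrimrecPred.exists_lt_comp (hs.comp π) ?_
    exact primrecPred_isSome (primrec_lookup (hc.comp (π.comp Primrec.fst))
      (Primrec.snd.comp (Primrec.fst.comp Primrec.fst)) (Primrec.snd.comp Primrec.fst) Primrec.snd)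
  refine h.of_eq fun x => ?_
  constructor
  · rintro ⟨⟨q, hq, hi⟩, ht⟩
    refine ⟨⟨⟨q, hq⟩, hi⟩, fun q a => ?_⟩
    obtain ⟨q', hq', h⟩ := ht q q.2 a a.2
    exact ⟨⟨q', hq'⟩, h⟩
  · rintro ⟨⟨q, hi⟩, ht⟩
    refine ⟨⟨q, q.2, hi⟩, fun q hq a ha => ?_⟩
    obtain ⟨q', h⟩ := ht ⟨q, hq⟩ ⟨a, ha⟩
    exact ⟨q', q'.2, h⟩

theorem primrecPred_valid : PrimrecPred Valid :=
  (Primrec.nat_le.comp (Primrec.const 2) (primrec_discount.comp primrec_fst)).and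
    ((Primrec.nat_le.comp (Primrec.const 2) (primrec_discount.comp primrec_snd)).and
      ((primrecPred_complete primrec_fst).and (primrecPred_complete primrec_snd)))

end NDAPair

/-! ### Integer weights. -/

namespace NDACode

open NDA DiscountedSystem Encodable

/-- The weights of an automaton, multiplied by `D`. -/
def scaledWeight (c : NDACode) (m D : ℕ) (t : Fin c.numStates × Fin m × Fin c.numStates) : ℤ :=
  posPart D (c.entry m t) - negPart D (c.entry m t)

theorem scaledWeight_of_entry_eq_none {c : NDACode} {m D : ℕ}
    {t : Fin c.numStates × Fin m × Fin c.numStates} (h : c.entry m t = none) :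
    c.scaledWeight m D t = 0 := by
  simp [scaledWeight, posPart, negPart, h]

theorem scaledWeight_of_entry_eq_some {c : NDACode} {m D : ℕ}
    {t : Fin c.numStates × Fin m × Fin c.numStates} {z : ℤ} {y : ℕ}
    (h : c.entry m t = some (z, y)) : c.scaledWeight m D t = z * (D / (y + 1) : ℕ) := by
  simp only [scaledWeight, posPart, negPart, h, Option.map_some, Option.getD_some]
  rw [Nat.cast_mul, Nat.cast_mul, ← sub_mul, Int.toNat_sub_toNat_neg z]

/-- Each denominator `y + 1` is at most `e + 1`, so it divides `(e + 1)!` and the division in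
`posPart` and `negPart` is exact. -/
theorem cast_scaledWeight {c : NDACode} {m e : ℕ} (he : encode c ≤ e)
    (t : Fin c.numStates × Fin m × Fin c.numStates) :
    (c.scaledWeight m (e + 1).factorial t : ℝ) =
      ((e + 1).factorial : ℕ) * ((c.toNDA m).weight t : ℝ) := by
  rcases h : c.entry m t with _ | ⟨z, y⟩
  · simp [scaledWeight_of_entry_eq_none h, toNDA, h]
  · have hy : y + 1 ∣ (e + 1).factorial :=
      Nat.dvd_factorial (Nat.succ_pos y) (by have := (c.le_encode_of_lookup h).2; omega)
    have hdiv : (((e + 1).factorial / (y + 1) : ℕ) : ℝ) = (e + 1).factorial / (y + 1) := by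
      rw [Nat.cast_div hy (by positivity)]
      push_cast
      rfl
    rw [scaledWeight_of_entry_eq_some h, Int.cast_mul, Int.cast_natCast, hdiv]
    simp only [toNDA, h, Option.map_some, Option.getD_some]
    push_cast
    field_simp

theorem abs_scaledWeight_le {c : NDACode} {m e D : ℕ} (he : encode c ≤ e)
    (t : Fin c.numStates × Fin m × Fin c.numStates) :
    |c.scaledWeight m D t| ≤ (D * e : ℕ) := by
  rcases h : c.entry m t with _ | ⟨z, y⟩
  · rw [scaledWeight_of_entry_eq_none h, abs_zero]
    positivity
  · have hz : z.natAbs ≤ e := (c.le_encode_of_lookup h).1.trans he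
    rw [scaledWeight_of_entry_eq_some h, abs_mul, Nat.abs_cast, Int.abs_eq_natAbs]
    have : z.natAbs * (D / (y + 1)) ≤ D * e := by
      rw [mul_comm D]
      exact Nat.mul_le_mul hz (Nat.div_le_self _ _)
    exact_mod_cast this

theorem gain_sub_gain {c : NDACode} (hc : 2 ≤ c.discount) (m D r : ℕ) (w : ℕ → Fin m)
    (p : ℕ → Fin c.numStates) (n : ℕ) :
    (c.gain posPart D r (fun i => (w i : ℕ)) (fun i => (p i : ℕ)) n : ℝ) -
      c.gain negPart D r (fun i => (w i : ℕ)) (fun i => (p i : ℕ)) n =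
    (c.discount : ℝ) ^ n * (r : ℝ) ^ n *
      discPrefix c.discount (runCost (c.scaledWeight m D) w p) n := by
  have hc' : (c.discount : ℝ) ≠ 0 := by exact_mod_cast (show c.discount ≠ 0 by omega)
  rw [gain, gain, discPrefix, Finset.mul_sum]
  push_cast
  rw [← Finset.sum_sub_distrib]
  refine Finset.sum_congr rfl fun i hi => ?_
  have hpow : (c.discount : ℝ) ^ n = c.discount ^ (n - i) * c.discount ^ i := by
    rw [← pow_add, Nat.sub_add_cancel (Finset.mem_range.1 hi).le]
  rw [hpow, runCost, scaledWeight, entry]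
  push_cast
  field_simp

end NDACode

/-! ### Correctness of the test. -/

namespace NDAPair

open NDA NDACode DiscountedSystem Encodable

theorem check_iff_forall_run {x : NDAPair} (hx : x.Valid) {n : ℕ} (hn : 0 < n) (D e₁ e₂ : ℕ) :
    x.Check n D e₁ e₂ ↔ ∀ (w : ℕ → Fin x.alphabetSize) (p : ℕ → Fin x.fst.numStates),
      x.A.IsRunUpTo w p n → ∃ p' : ℕ → Fin x.snd.numStates, x.B.IsRunUpTo w p' n ∧
        x.CostsMore D e₁ e₂ (fun i => (w i : ℕ)) (fun i => (p i : ℕ)) (fun i => (p' i : ℕ)) n := by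
  have hcong : ∀ {w w' p p' q q' : ℕ → ℕ}, (∀ i < n, w i = w' i) → (∀ i < n + 1, p i = p' i) →
      (∀ i < n + 1, q i = q' i) →
      (x.CostsMore D e₁ e₂ w p q n ↔ x.CostsMore D e₁ e₂ w' p' q' n) := by
    intro w w' p p' q q' hw hp hq
    rw [CostsMore, CostsMore, gain_congr _ _ _ _ hw hp, gain_congr _ _ _ _ hw hp,
      gain_congr _ _ _ _ hw hq, gain_congr _ _ _ _ hw hq]
  obtain ⟨qA, -⟩ := hx.2.2.1.1
  obtain ⟨qB, -⟩ := hx.2.2.2.1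
  have hA : 0 < x.fst.numStates := qA.pos
  have hB : 0 < x.snd.numStates := qB.pos
  constructor
  · intro h w p hp
    obtain ⟨k, hk, hkw⟩ := exists_digitSeq_eq n (fun i => (w i : ℕ)) fun i _ => (w i).2
    obtain ⟨q, hq, hqp⟩ := exists_digitSeq_eq (n + 1) (fun i => (p i : ℕ)) fun i _ => (p i).2
    rcases h k hk q hq with h | ⟨q', -, hrun, hcost⟩
    · exact absurd ((isRunSeq_congr hkw hqp).2 hp) h
    · exact ⟨fun i => ⟨digitSeq x.snd.numStates q' i, digitSeq_lt hB q' i⟩,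
        (isRunSeq_congr hkw fun _ _ => rfl).1 hrun, (hcong hkw hqp fun _ _ => rfl).1 hcost⟩
  · intro h k hk q hq
    -- Over an empty alphabet there is no `w : ℕ → Fin 0`, while `0 ^ n` would count one word for `n
    -- = 0`; this is where `hn` is needed.
    have hm : 0 < x.alphabetSize := by
      rcases Nat.eq_zero_or_pos x.alphabetSize with h0 | h0
      · rw [h0, zero_pow hn.ne'] at hk
        exact absurd hk (Nat.not_lt_zero k)
      · exact h0
    rw [or_iff_not_imp_left, not_not]
    intro hrun
    obtain ⟨p', hp', hcost⟩ := h (fun i => ⟨digitSeq x.alphabetSize k i, digitSeq_lt hm k i⟩)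
      (fun i => ⟨digitSeq x.fst.numStates q i, digitSeq_lt hA q i⟩) hrun
    obtain ⟨q', hq', hqp⟩ := exists_digitSeq_eq (n + 1) (fun i => (p' i : ℕ)) fun i _ => (p' i).2
    exact ⟨q', hq', (isRunSeq_congr (fun _ _ => rfl) hqp).2 hp',
      (hcong (fun _ _ => rfl) (fun _ _ => rfl) hqp).2 hcost⟩

/-- The product of the discount factors, each to the power `n`. -/
def scale (x : NDAPair) (n : ℕ) : ℝ := (x.fst.discount : ℝ) ^ n * (x.snd.discount : ℝ) ^ n

theorem Valid.scale_pos {x : NDAPair} (hx : x.Valid) (n : ℕ) : 0 < x.scale n := by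
  have h1 : (0 : ℝ) < x.fst.discount := by exact_mod_cast (show 0 < _ by have := hx.1; omega)
  have h2 : (0 : ℝ) < x.snd.discount := by exact_mod_cast (show 0 < _ by have := hx.2.1; omega)
  unfold scale
  positivity

theorem Valid.gain_identity {x : NDAPair} (hx : x.Valid) (D n : ℕ) (w : ℕ → Fin x.alphabetSize)
    (p : ℕ → Fin x.fst.numStates) (p' : ℕ → Fin x.snd.numStates) :
    (x.fst.gain posPart D x.snd.discount (fun i => (w i : ℕ)) (fun i => (p i : ℕ)) n : ℝ) +
      x.snd.gain negPart D x.fst.discount (fun i => (w i : ℕ)) (fun i => (p' i : ℕ)) n -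
      (x.snd.gain posPart D x.fst.discount (fun i => (w i : ℕ)) (fun i => (p' i : ℕ)) n +
      x.fst.gain negPart D x.snd.discount (fun i => (w i : ℕ)) (fun i => (p i : ℕ)) n) =
    x.scale n * (discPrefix x.fst.discount (runCost (x.fst.scaledWeight _ D) w p) n -
      discPrefix x.snd.discount (runCost (x.snd.scaledWeight _ D) w p') n) := by
  have h1 := gain_sub_gain hx.1 _ D x.snd.discount w p n
  have h2 := gain_sub_gain hx.2.1 _ D x.fst.discount w p' n
  rw [scale]
  linear_combination h1 - h2

theorem Valid.costsMore_iff_lt {x : NDAPair} (hx : x.Valid) (D E n : ℕ)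
    (w : ℕ → Fin x.alphabetSize) (p : ℕ → Fin x.fst.numStates) (p' : ℕ → Fin x.snd.numStates) :
    x.CostsMore D 0 E (fun i => (w i : ℕ)) (fun i => (p i : ℕ)) (fun i => (p' i : ℕ)) n ↔
      E / x.scale n < discPrefix x.fst.discount (runCost (x.fst.scaledWeight _ D) w p) n -
        discPrefix x.snd.discount (runCost (x.snd.scaledWeight _ D) w p') n := by
  have h := hx.gain_identity D n w p p'
  rw [div_lt_iff₀' (hx.scale_pos n), ← h, CostsMore, ← Nat.cast_lt (α := ℝ)]
  push_cast
  constructor <;> intro h <;> linarith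

/-- The extra `1` turns the strict inequality of natural numbers in `CostsMore` into a weak one. -/
theorem Valid.costsMore_iff_le {x : NDAPair} (hx : x.Valid) (D E n : ℕ)
    (w : ℕ → Fin x.alphabetSize) (p : ℕ → Fin x.fst.numStates) (p' : ℕ → Fin x.snd.numStates) :
    x.CostsMore D (E + 1) 0 (fun i => (w i : ℕ)) (fun i => (p i : ℕ)) (fun i => (p' i : ℕ)) n ↔
      0 ≤ discPrefix x.fst.discount (runCost (x.fst.scaledWeight _ D) w p) n -
        discPrefix x.snd.discount (runCost (x.snd.scaledWeight _ D) w p') n + E / x.scale n := by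
  have h := hx.gain_identity D n w p p'
  rw [← neg_le_iff_add_nonneg, ← neg_div, div_le_iff₀' (hx.scale_pos n), ← h, CostsMore, ← add_assoc,
    Nat.lt_succ_iff, ← Nat.cast_le (α := ℝ)]
  push_cast
  constructor <;> intro h <;> linarith

/-- A common denominator of the weights of inputs whose code is at most `e`. -/
def weightDenom (e : ℕ) : ℕ := (e + 1).factorial

/-- A bound on the scaled costs. -/
def costBound (e : ℕ) : ℕ := 2 * (weightDenom e * e)

/-- A bound on the number of configurations of the determinizations. -/
def configBound (e : ℕ) : ℕ := (4 * costBound e + 1 + 1) ^ (2 * e) + 1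

/-- The length up to which finite words are examined. -/
def finBound (e : ℕ) : ℕ := horizon (e + 1) (configBound e + 1) (costBound e)

/-- The length of the prefixes of infinite words that are examined. -/
def infBound (e : ℕ) : ℕ := horizon (e + 1) (configBound e) (costBound e)

/-- A bound on what the letters beyond the examined prefix can contribute. -/
def tailBound (x : NDAPair) (n : ℕ) : ℕ :=
  2 * costBound (encode x) * (x.fst.discount ^ n + x.snd.discount ^ n)

theorem Valid.tailBound_div_scale {x : NDAPair} (hx : x.Valid) (n : ℕ) :
    x.tailBound n / x.scale n = 2 * (costBound (encode x) : ℝ) / (x.fst.discount : ℝ) ^ n +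
      2 * (costBound (encode x) : ℝ) / (x.snd.discount : ℝ) ^ n := by
  have h1 : (x.fst.discount : ℝ) ≠ 0 := by exact_mod_cast (show _ ≠ 0 by have := hx.1; omega)
  have h2 : (x.snd.discount : ℝ) ≠ 0 := by exact_mod_cast (show _ ≠ 0 by have := hx.2.1; omega)
  rw [tailBound, scale]
  push_cast
  field_simp
  ring

/-- A deterministic system whose values are the differences of the values of the two automata. -/
theorem Valid.exists_system {x : NDAPair} (hx : x.Valid) :
    ∃ (S : Type) (_ : Fintype S) (step : S → Fin x.alphabetSize → S)
      (a b : S → Fin x.alphabetSize → ℤ) (s : S),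
      (∀ K, configBound (encode x) ≤ K → IsBounded a b x.fst.discount x.snd.discount
        (encode x + 1) K (costBound (encode x))) ∧
      (∀ w n, x.A.finValue (fun i : Fin n => w i) > x.B.finValue (fun i : Fin n => w i) ↔
        0 < prefixTotal step a b x.fst.discount x.snd.discount s w n) ∧
      (∀ w n, x.A.finValue (fun i : Fin n => w i) ≥ x.B.finValue (fun i : Fin n => w i) ↔
        0 ≤ prefixTotal step a b x.fst.discount x.snd.discount s w n) ∧
      (∀ w, x.A.infValue w > x.B.infValue w ↔
        0 < total step a b x.fst.discount x.snd.discount s w) ∧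
      (∀ w, x.A.infValue w ≥ x.B.infValue w ↔
        0 ≤ total step a b x.fst.discount x.snd.discount s w) ∧
      (∀ n E, 0 < n → (x.Check n (weightDenom (encode x)) 0 E ↔
        ∀ w, E / x.scale n < prefixTotal step a b x.fst.discount x.snd.discount s w n)) ∧
      (∀ n E, 0 < n → (x.Check n (weightDenom (encode x)) (E + 1) 0 ↔
        ∀ w, 0 ≤ prefixTotal step a b x.fst.discount x.snd.discount s w n + E / x.scale n)) := by
  classical
  set e := encode x
  set D := weightDenom e
  set M := D * e
  set T := 4 * costBound e + 1
  have hD0 : 0 < D := Nat.factorial_pos _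
  have hD0' : (0 : ℝ) < D := by exact_mod_cast hD0
  have hMT : 4 * M ≤ T := by
    change 4 * (D * e) ≤ 4 * (2 * (D * e)) + 1
    omega
  have hγA := cast_scaledWeight (m := x.alphabetSize) x.encode_fst_le
  have hγB := cast_scaledWeight (m := x.alphabetSize) x.encode_snd_le
  have hMA := abs_scaledWeight_le (m := x.alphabetSize) (D := D) x.encode_fst_le
  have hMB := abs_scaledWeight_le (m := x.alphabetSize) (D := D) x.encode_snd_le
  obtain ⟨stepA, cA, sA, hcA, hA⟩ :=
    hx.2.2.1.exists_determinization (T := T) hx.1 hMA (Nat.succ_pos _) hMT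
  obtain ⟨stepB, cB, sB, hcB, hB⟩ :=
    hx.2.2.2.exists_determinization (T := T) hx.2.1 hMB (Nat.succ_pos _) hMT
  let _ : Fintype (Config (Fin x.fst.numStates) T) := Fintype.ofFinite _
  let _ : Fintype (Config (Fin x.snd.numStates) T) := Fintype.ofFinite _
  have hfA := fun (w : ℕ → Fin x.alphabetSize) n => hA.finValue_eq hD0 hγA w n
  have hfB := fun (w : ℕ → Fin x.alphabetSize) n => hB.finValue_eq hD0 hγB w n
  have hiA := fun (w : ℕ → Fin x.alphabetSize) => hA.infValue_eq hx.1 hD0 hγA hMA hcA w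
  have hiB := fun (w : ℕ → Fin x.alphabetSize) => hB.infValue_eq hx.2.1 hD0 hγB hMB hcB w
  set step : Config (Fin x.fst.numStates) T × Config (Fin x.snd.numStates) T → Fin x.alphabetSize →
    Config (Fin x.fst.numStates) T × Config (Fin x.snd.numStates) T :=
    fun s y => (stepA s.1 y, stepB s.2 y) with hstep
  have hstate : ∀ w n, stateAt step (sA, sB) w n = (stateAt stepA sA w n, stateAt stepB sB w n) := by
    intro w n
    induction n with
    | zero => rfl
    | succ n ih => rw [stateAt, ih]; rfl
  -- The cost of the second automaton enters with a minus sign, so positive values mean that the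
  -- first automaton is dearer.
  have hpre : ∀ w n, prefixTotal step (fun s y => cA s.1 y) (fun s y => - cB s.2 y)
      x.fst.discount x.snd.discount (sA, sB) w n =
      discPrefix x.fst.discount (costAt stepA cA sA w) n -
        discPrefix x.snd.discount (costAt stepB cB sB w) n := by
    intro w n
    simp only [prefixTotal, discPrefix, costAt, hstate]
    push_cast
    simp only [neg_div, Finset.sum_neg_distrib]
    ring
  have htot : ∀ w, total step (fun s y => cA s.1 y) (fun s y => - cB s.2 y)
      x.fst.discount x.snd.discount (sA, sB) w =
      disc x.fst.discount (costAt stepA cA sA w) - disc x.snd.discount (costAt stepB cB sB w) := by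
    intro w
    simp only [total, disc, costAt, hstate]
    push_cast
    simp only [neg_div, tsum_neg]
    ring
  refine ⟨_, inferInstance, step, fun s y => cA s.1 y, fun s y => - cB s.2 y, (sA, sB),
    fun K hK => ?_, fun w n => ?_, fun w n => ?_, fun w => ?_, fun w => ?_, fun n E hn => ?_,
    fun n E hn => ?_⟩
  · refine ⟨hx.1, hx.2.1, Nat.lt_succ_of_le (x.fst.discount_le_encode.trans x.encode_fst_le),
      Nat.lt_succ_of_le (x.snd.discount_le_encode.trans x.encode_snd_le), ?_, fun s y => ?_⟩
    · refine lt_of_lt_of_le (Nat.lt_succ_of_le ?_) hK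
      have h1 := card_config_le (Q := Fin x.fst.numStates) T
      have h2 := card_config_le (Q := Fin x.snd.numStates) T
      rw [Fintype.card_fin] at h1 h2
      rw [Fintype.card_prod, two_mul, pow_add]
      exact Nat.mul_le_mul
        (h1.trans (Nat.pow_le_pow_right (by omega)
          (x.fst.numStates_le_encode.trans x.encode_fst_le)))
        (h2.trans (Nat.pow_le_pow_right (by omega)
          (x.snd.numStates_le_encode.trans x.encode_snd_le)))
    · rw [abs_neg, costBound, two_mul]
      push_cast
      exact_mod_cast add_le_add (hcA s.1 y) (hcB s.2 y)
  · rw [hfA, hfB, gt_iff_lt, EReal.coe_lt_coe_iff, div_lt_div_iff_of_pos_right hD0', hpre, sub_pos]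
  · rw [hfA, hfB, ge_iff_le, EReal.coe_le_coe_iff, div_le_div_iff_of_pos_right hD0', hpre,
      sub_nonneg]
  · rw [hiA, hiB, gt_iff_lt, EReal.coe_lt_coe_iff, div_lt_div_iff_of_pos_right hD0', htot, sub_pos]
  · rw [hiA, hiB, ge_iff_le, EReal.coe_le_coe_iff, div_le_div_iff_of_pos_right hD0', htot,
      sub_nonneg]
  · rw [check_iff_forall_run hx hn]
    refine forall_congr' fun w => ?_
    simp only [hx.costsMore_iff_lt, hpre]
    -- Applying the test to an optimal run of the first automaton bounds the least costs; conversely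
    -- an optimal run of the second one answers every run of the first.
    constructor
    · intro h
      obtain ⟨p, hp, hpA⟩ := hA.exists_eq w n
      obtain ⟨p', hp', hlt⟩ := h p (hp.isRunUpTo n)
      have := hB.le w p' n hp'
      linarith
    · intro h p hp
      obtain ⟨p', hp', hpB⟩ := hB.exists_eq w n
      have := hA.le w p n hp
      exact ⟨p', hp'.isRunUpTo n, by linarith⟩
  · rw [check_iff_forall_run hx hn]
    refine forall_congr' fun w => ?_
    simp only [hx.costsMore_iff_le, hpre]
    constructor
    · intro h
      obtain ⟨p, hp, hpA⟩ := hA.exists_eq w n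
      obtain ⟨p', hp', hlt⟩ := h p (hp.isRunUpTo n)
      have := hB.le w p' n hp'
      linarith
    · intro h p hp
      obtain ⟨p', hp', hpB⟩ := hB.exists_eq w n
      have := hA.le w p n hp
      exact ⟨p', hp'.isRunUpTo n, by linarith⟩

/-- Every nonempty finite word is a prefix of an infinite one. -/
theorem forall_finite_word_iff {m : ℕ} {P : ∀ n, (Fin (n + 1) → Fin m) → Prop} :
    (∀ n w, P n w) ↔ ∀ n (w : ℕ → Fin m), P n fun i => w i := by
  refine ⟨fun h n w => h n _, fun h n w => ?_⟩
  have := h n fun i => if hi : i < n + 1 then w ⟨i, hi⟩ else w 0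
  convert this using 1
  funext i
  rw [dif_pos i.isLt]

theorem Valid.finValue_gt_iff {x : NDAPair} (hx : x.Valid) :
    (∀ (n : ℕ) (w : Fin (n + 1) → Fin x.alphabetSize), x.A.finValue w > x.B.finValue w) ↔
      ∀ n < finBound (encode x), x.Check (n + 1) (weightDenom (encode x)) 0 0 := by
  obtain ⟨S, _, step, a, b, s, hb, hfin, -, -, -, hcheck, -⟩ := hx.exists_system
  rw [forall_finite_word_iff (P := fun n w => x.A.finValue w > x.B.finValue w)]
  simp only [hfin, (hb _ le_rfl).forall_prefixTotal_pos_iff s, hcheck _ _ (Nat.succ_pos _),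
    Nat.cast_zero, zero_div, finBound]

theorem Valid.finValue_ge_iff {x : NDAPair} (hx : x.Valid) :
    (∀ (n : ℕ) (w : Fin (n + 1) → Fin x.alphabetSize), x.A.finValue w ≥ x.B.finValue w) ↔
      ∀ n < finBound (encode x), x.Check (n + 1) (weightDenom (encode x)) (0 + 1) 0 := by
  obtain ⟨S, _, step, a, b, s, hb, -, hfin, -, -, -, hcheck⟩ := hx.exists_system
  rw [forall_finite_word_iff (P := fun n w => x.A.finValue w ≥ x.B.finValue w)]
  simp only [hfin, (hb _ le_rfl).forall_prefixTotal_nonneg_iff s, hcheck _ _ (Nat.succ_pos _),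
    Nat.cast_zero, zero_div, add_zero, finBound]

/-- One test at a single length suffices, with the tail as slack; finite words need all lengths up
to the bound, but no slack. -/
theorem Valid.infValue_gt_iff {x : NDAPair} (hx : x.Valid) :
    (∀ w : ℕ → Fin x.alphabetSize, x.A.infValue w > x.B.infValue w) ↔
      x.Check (infBound (encode x)) (weightDenom (encode x)) 0
        (x.tailBound (infBound (encode x))) := by
  obtain ⟨S, _, step, a, b, s, hb, -, -, hinf, -, hcheck, -⟩ := hx.exists_system
  rw [hcheck _ _ (show 0 < infBound (encode x) from Nat.succ_pos _), hx.tailBound_div_scale]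
  simp only [hinf]
  exact (hb _ le_rfl).forall_total_pos_iff s

theorem Valid.infValue_ge_iff {x : NDAPair} (hx : x.Valid) :
    (∀ w : ℕ → Fin x.alphabetSize, x.A.infValue w ≥ x.B.infValue w) ↔
      x.Check (infBound (encode x)) (weightDenom (encode x))
        (x.tailBound (infBound (encode x)) + 1) 0 := by
  obtain ⟨S, _, step, a, b, s, hb, -, -, -, hinf, -, hcheck⟩ := hx.exists_system
  rw [hcheck _ _ (show 0 < infBound (encode x) from Nat.succ_pos _), hx.tailBound_div_scale]
  simp only [hinf]
  exact (hb _ le_rfl).forall_total_nonneg_iff s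

/-! ### Primitive recursiveness of the bounds and of the six problems. -/

theorem primrec_weightDenom : Primrec weightDenom := Primrec.nat_factorial.comp Primrec.succ

theorem primrec_costBound : Primrec costBound :=
  Primrec.nat_mul.comp (Primrec.const 2) (Primrec.nat_mul.comp primrec_weightDenom Primrec.id)

theorem primrec_configBound : Primrec configBound :=
  Primrec.succ.comp (Primrec.nat_pow.comp
    (Primrec.succ.comp (Primrec.succ.comp (Primrec.nat_mul.comp (Primrec.const 4)
      primrec_costBound)))
    (Primrec.nat_mul.comp (Primrec.const 2) Primrec.id))

theorem primrec_horizon {L K M : ℕ → ℕ} (hL : Primrec L) (hK : Primrec K) (hM : Primrec M) :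
    Primrec fun e => horizon (L e) (K e) (M e) := by
  have hfac : Primrec fun e => (L e ^ K e).factorial :=
    Primrec.nat_factorial.comp (Primrec.nat_pow.comp hL hK)
  have hthr : Primrec fun e => threshold (L e) (K e) (M e) :=
    Primrec.succ.comp (Primrec.nat_mul.comp (Primrec.nat_pow.comp hL (Primrec.const 2))
      (Primrec.nat_mul.comp hfac (Primrec.nat_mul.comp (Primrec.const 4) hM)))
  have hden : Primrec fun e => denom (L e) (K e) (M e) :=
    Primrec.nat_mul.comp hfac (Primrec.nat_pow.comp (Primrec.nat_factorial.comp hL) hthr)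
  exact Primrec.succ.comp (Primrec.nat_add.comp (Primrec.nat_add.comp
    (Primrec.nat_mul.comp (Primrec.nat_mul.comp (Primrec.const 8) hM) hden) hthr) hK)

theorem primrec_finBound : Primrec finBound :=
  primrec_horizon Primrec.succ (Primrec.succ.comp primrec_configBound) primrec_costBound

theorem primrec_infBound : Primrec infBound :=
  primrec_horizon Primrec.succ primrec_configBound primrec_costBound

theorem primrec_tailBound : Primrec fun x : NDAPair => x.tailBound (infBound (encode x)) := by
  have hn := primrec_infBound.comp (Primrec.encode (α := NDAPair))
  exact Primrec.nat_mul.comp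
    (Primrec.nat_mul.comp (Primrec.const 2) (primrec_costBound.comp Primrec.encode))
    (Primrec.nat_add.comp
      (Primrec.nat_pow.comp (primrec_discount.comp primrec_fst) hn)
      (Primrec.nat_pow.comp (primrec_discount.comp primrec_snd) hn))

theorem primrecPred_valid_and {P Q : NDAPair → Prop} (hQ : PrimrecPred Q)
    (h : ∀ x : NDAPair, x.Valid → (P x ↔ Q x)) : PrimrecPred fun x => x.Valid ∧ P x :=
  (primrecPred_valid.and hQ).of_eq fun x => and_congr_right fun hx => (h x hx).symm

theorem primrecPred_finValue_gt : PrimrecPred fun x : NDAPair => x.Valid ∧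
    ∀ (n : ℕ) (w : Fin (n + 1) → Fin x.alphabetSize), x.A.finValue w > x.B.finValue w := by
  refine primrecPred_valid_and ?_ fun x hx => hx.finValue_gt_iff
  refine PrimrecPred.forall_lt_comp (primrec_finBound.comp Primrec.encode) ?_
  exact primrecPred_check Primrec.fst (Primrec.succ.comp Primrec.snd)
    (primrec_weightDenom.comp (Primrec.encode.comp Primrec.fst)) (Primrec.const 0) (Primrec.const 0)

theorem primrecPred_finValue_ge : PrimrecPred fun x : NDAPair => x.Valid ∧
    ∀ (n : ℕ) (w : Fin (n + 1) → Fin x.alphabetSize), x.A.finValue w ≥ x.B.finValue w := by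
  refine primrecPred_valid_and ?_ fun x hx => hx.finValue_ge_iff
  refine PrimrecPred.forall_lt_comp (primrec_finBound.comp Primrec.encode) ?_
  exact primrecPred_check Primrec.fst (Primrec.succ.comp Primrec.snd)
    (primrec_weightDenom.comp (Primrec.encode.comp Primrec.fst)) (Primrec.const (0 + 1))
    (Primrec.const 0)

theorem primrecPred_infValue_gt : PrimrecPred fun x : NDAPair => x.Valid ∧
    ∀ w : ℕ → Fin x.alphabetSize, x.A.infValue w > x.B.infValue w :=
  primrecPred_valid_and
    (primrecPred_check Primrec.id (primrec_infBound.comp Primrec.encode)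
      (primrec_weightDenom.comp Primrec.encode) (Primrec.const 0) primrec_tailBound)
    fun _ hx => hx.infValue_gt_iff

theorem primrecPred_infValue_ge : PrimrecPred fun x : NDAPair => x.Valid ∧
    ∀ w : ℕ → Fin x.alphabetSize, x.A.infValue w ≥ x.B.infValue w :=
  primrecPred_valid_and
    (primrecPred_check Primrec.id (primrec_infBound.comp Primrec.encode)
      (primrec_weightDenom.comp Primrec.encode) (Primrec.succ.comp primrec_tailBound)
      (Primrec.const 0))
    fun _ hx => hx.infValue_ge_iff

theorem valid_swap {x : NDAPair} : x.swap.Valid ↔ x.Valid := by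
  unfold Valid swap
  tauto

theorem primrecPred_finValue_eq : PrimrecPred fun x : NDAPair => x.Valid ∧
    ∀ (n : ℕ) (w : Fin (n + 1) → Fin x.alphabetSize), x.A.finValue w = x.B.finValue w := by
  refine (primrecPred_finValue_ge.and (primrecPred_finValue_ge.comp primrec_swap)).of_eq fun x => ?_
  rw [valid_swap]
  exact ⟨fun h => ⟨h.1.1, fun n w => le_antisymm (h.2.2 n w) (h.1.2 n w)⟩,
    fun h => ⟨⟨h.1, fun n w => (h.2 n w).ge⟩, h.1, fun n w => (h.2 n w).le⟩⟩

theorem primrecPred_infValue_eq : PrimrecPred fun x : NDAPair => x.Valid ∧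
    ∀ w : ℕ → Fin x.alphabetSize, x.A.infValue w = x.B.infValue w := by
  refine (primrecPred_infValue_ge.and (primrecPred_infValue_ge.comp primrec_swap)).of_eq fun x => ?_
  rw [valid_swap]
  exact ⟨fun h => ⟨h.1.1, fun w => le_antisymm (h.2.2 w) (h.1.2 w)⟩,
    fun h => ⟨⟨h.1, fun w => (h.2 w).ge⟩, h.1, fun w => (h.2 w).le⟩⟩

end NDAPair

theorem mainTheorem5 :
    -- finite (nonempty) words
    (ComputablePred fun x : NDAPair => x.Valid ∧
      ∀ (n : ℕ) (w : Fin (n + 1) → Fin x.alphabetSize), x.A.finValue w > x.B.finValue w) ∧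
    (ComputablePred fun x : NDAPair => x.Valid ∧
      ∀ (n : ℕ) (w : Fin (n + 1) → Fin x.alphabetSize), x.A.finValue w ≥ x.B.finValue w) ∧
    (ComputablePred fun x : NDAPair => x.Valid ∧
      ∀ (n : ℕ) (w : Fin (n + 1) → Fin x.alphabetSize), x.A.finValue w = x.B.finValue w) ∧
    -- infinite words
    (ComputablePred fun x : NDAPair => x.Valid ∧
      ∀ w : ℕ → Fin x.alphabetSize, x.A.infValue w > x.B.infValue w) ∧
    (ComputablePred fun x : NDAPair => x.Valid ∧
      ∀ w : ℕ → Fin x.alphabetSize, x.A.infValue w ≥ x.B.infValue w) ∧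
    (ComputablePred fun x : NDAPair => x.Valid ∧
      ∀ w : ℕ → Fin x.alphabetSize, x.A.infValue w = x.B.infValue w) :=
  ⟨NDAPair.primrecPred_finValue_gt.computablePred, NDAPair.primrecPred_finValue_ge.computablePred,
    NDAPair.primrecPred_finValue_eq.computablePred, NDAPair.primrecPred_infValue_gt.computablePred,
    NDAPair.primrecPred_infValue_ge.computablePred, NDAPair.primrecPred_infValue_eq.computablePred⟩
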